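/- **Proposition 4.3 (Well-posedness with box constraints).** Let $\Omega\subseteq\mathbb R^d$ ($d\ge 1$) be open, bounded and connected with Lipschitz boundary, let $f\in L^2(\Omega)$ and $L_1,L_2>0$. For $\lambda_1,\lambda_2\ge 0$ and $u\in BV(\Omega)$ put $$\Phi^{\lambda_1,\lambda_2}(u,f)=\inf_{v\in L^1(\Omega)}\ \lambda_1\|v\|_{L^1(\Omega)}+\frac{\lambda_2}{2}\|f-u-v\|_{L^2(\Omega)}^2\qquad(0\cdot\infty=0),$$ and let $S(\lambda_1,\lambda_2)=\operatorname{argmin}_{u\in BV(\Omega)}\,|Du|(\Omega)+\Phi^{\lambda_1,\lambda_2}(u,f)$. Let $F:BV(\Omega)\to[0,\infty]$ be one of the following cost functionals: (a) the $L^2$ cost $F(u)=\|u-\tilde u\|_{L^2(\Omega)}^2$, where $\tilde u\in L^2(\Omega)$; (b) the Huberised TV cost $F(u)=\|D(u-\tilde u)\|_{\mathcal M,\gamma}$, where $\tilde u\in BV(\Omega)$, $\gamma\ge\frac12$, and $\|Dw\|_{\mathcal M,\gamma}=\int_\Omega|\nabla w|_\gamma\,dx+|D^s w|(\Omega)$ for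 the Lebesgue decomposition $Dw=\nabla w\,dx+D^sw$. Here $|z|_\gamma=\int_0^{|z|}\eta_\gamma(r)\,dr$ for $z\in\mathbb R^d$, with $\eta_\gamma(r)=1$ if $\gamma r-1\ge\frac1{2\gamma}$, $\eta_\gamma(r)=\gamma r$ if $\gamma r-1\le-\frac1{2\gamma}$, and $\eta_\gamma(r)=1-\frac\gamma2\left(1-\gamma r+\frac1{2\gamma}\right)^2$ otherwise. Then the non-smooth TV–IC bilevel problem $$\min\{F(u):\ 0\le\lambda_1\le L_1,\ 0\le\lambda_2\le L_2,\ u\in S(\lambda_1,\lambda_2)\}$$ admits an optimal parameter pair: there are $(\hat\lambda_1,\hat\lambda_2)\in[0,L_1]\times[0,L_2]$ and $\hat u\in S(\hat\lambda_1,\hat\lambda_2)$ such that $F(\hat u)\le F(u)$ for all $(\lambda_1,\lambda_2)\in[0,L_1]\times[0,L_2]$ and all $u\in S(\lambda_1,\lambda_2)$. -/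

import Mathlib

open MeasureTheory Set
open scoped ENNReal NNReal ContDiff

noncomputable section

namespace TVIC

variable {d : ℕ}

/-- `Ω` has Lipschitz boundary: near each boundary point, and after the choice of a unit direction
`e`, the set `Ω` is the strict epigraph over the hyperplane orthogonal to `e` of a Lipschitz
function `ψ` (only the values of `ψ` on that hyperplane are used). -/
def HasLipschitzBoundary (Ω : Set (EuclideanSpace ℝ (Fin d))) : Prop :=
  ∀ x ∈ frontier Ω, ∃ r : ℝ, 0 < r ∧ ∃ e : EuclideanSpace ℝ (Fin d), ‖e‖ = 1 ∧
    ∃ (K : ℝ≥0) (ψ : EuclideanSpace ℝ (Fin d) → ℝ), LipschitzWith K ψ ∧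
      Ω ∩ Metric.ball x r = {y ∈ Metric.ball x r | ψ (y - inner ℝ y e • e) < inner ℝ y e}

/-- The finite `ℝᵈ`-valued Borel measure `μ`, concentrated on `Ω`, is the distributional gradient
of `u` in `Ω`: `∫_Ω u ∇φ dx = - ∫_Ω φ dμ` for all test functions `φ ∈ C_c^∞(Ω)`. -/
structure IsDistribGradient (Ω : Set (EuclideanSpace ℝ (Fin d)))
    (u : EuclideanSpace ℝ (Fin d) → ℝ)
    (μ : VectorMeasure (EuclideanSpace ℝ (Fin d)) (EuclideanSpace ℝ (Fin d))) : Prop where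
  finite : μ.variation univ ≠ ⊤
  concentrated : μ.variation Ωᶜ = 0
  integral_eq : ∀ φ : EuclideanSpace ℝ (Fin d) → ℝ, ContDiff ℝ ∞ φ → HasCompactSupport φ →
    tsupport φ ⊆ Ω → ∫ x in Ω, u x • gradient φ x = - ∫ᵛ x, φ x ∂•μ

/-- `u ∈ BV(Ω)`: `u ∈ L¹(Ω)` and its distributional gradient in `Ω` is a finite vector measure. -/
def IsBV (Ω : Set (EuclideanSpace ℝ (Fin d))) (u : EuclideanSpace ℝ (Fin d) → ℝ) : Prop :=
  IntegrableOn u Ω ∧ ∃ μ, IsDistribGradient Ω u μ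

open Classical in
/-- The (unique) measure `Du` of a function `u ∈ BV(Ω)`; the value for `u ∉ BV(Ω)` is never used. -/
def distribGradient (Ω : Set (EuclideanSpace ℝ (Fin d))) (u : EuclideanSpace ℝ (Fin d) → ℝ) :
    VectorMeasure (EuclideanSpace ℝ (Fin d)) (EuclideanSpace ℝ (Fin d)) :=
  if h : ∃ μ, IsDistribGradient Ω u μ then h.choose else 0

/-- The total variation `|Du|(Ω)` of `u ∈ BV(Ω)`. -/
def totalVariation (Ω : Set (EuclideanSpace ℝ (Fin d))) (u : EuclideanSpace ℝ (Fin d) → ℝ) :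
    ℝ≥0∞ :=
  (distribGradient Ω u).variation Ω

/-- The `i`-th component of an `ℝᵈ`-valued measure. -/
def component (μ : VectorMeasure (EuclideanSpace ℝ (Fin d)) (EuclideanSpace ℝ (Fin d)))
    (i : Fin d) : SignedMeasure (EuclideanSpace ℝ (Fin d)) :=
  μ.mapRange (EuclideanSpace.proj i : EuclideanSpace ℝ (Fin d) →L[ℝ] ℝ).toLinearMap.toAddMonoidHom
    (EuclideanSpace.proj i : EuclideanSpace ℝ (Fin d) →L[ℝ] ℝ).continuous

/-- The density, with respect to Lebesgue measure, of the absolutely continuous part of an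
`ℝᵈ`-valued measure. For `μ = Du` it is the approximate gradient `∇u`. -/
def acDensity (μ : VectorMeasure (EuclideanSpace ℝ (Fin d)) (EuclideanSpace ℝ (Fin d)))
    (x : EuclideanSpace ℝ (Fin d)) : EuclideanSpace ℝ (Fin d) :=
  WithLp.toLp 2 fun i => (component μ i).rnDeriv volume x

/-- The singular part, with respect to Lebesgue measure, of an `ℝᵈ`-valued measure.
For `μ = Du` it is `Dˢu`. -/
def singularPart (μ : VectorMeasure (EuclideanSpace ℝ (Fin d)) (EuclideanSpace ℝ (Fin d))) :
    VectorMeasure (EuclideanSpace ℝ (Fin d)) (EuclideanSpace ℝ (Fin d)) :=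
  μ - volume.withDensityᵥ (acDensity μ)

/-- The `L¹`–`L²` infimal convolution fidelity
`Φ^{λ₁,λ₂}(u,f) = inf_{v ∈ L¹(Ω)} λ₁ ‖v‖_{L¹(Ω)} + (λ₂/2) ‖f - u - v‖²_{L²(Ω)}`. The `L²` norm may
be infinite, and `0 · ∞ = 0`. -/
def fidelity (Ω : Set (EuclideanSpace ℝ (Fin d))) (lam₁ lam₂ : ℝ)
    (u f : EuclideanSpace ℝ (Fin d) → ℝ) : ℝ≥0∞ :=
  ⨅ (v : EuclideanSpace ℝ (Fin d) → ℝ) (_ : IntegrableOn v Ω),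
    ENNReal.ofReal lam₁ * eLpNorm v 1 (volume.restrict Ω) +
      ENNReal.ofReal (lam₂ / 2) * eLpNorm (fun x => f x - u x - v x) 2 (volume.restrict Ω) ^ 2

/-- The solution set of the lower level problem
`argmin_{u ∈ BV(Ω)} |Du|(Ω) + Φ^{λ₁,λ₂}(u,f)`. -/
def lowerArgmin (Ω : Set (EuclideanSpace ℝ (Fin d))) (f : EuclideanSpace ℝ (Fin d) → ℝ)
    (lam₁ lam₂ : ℝ) : Set (EuclideanSpace ℝ (Fin d) → ℝ) :=
  {u | IsBV Ω u ∧ ∀ w, IsBV Ω w →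
    totalVariation Ω u + fidelity Ω lam₁ lam₂ u f ≤ totalVariation Ω w + fidelity Ω lam₁ lam₂ w f}

/-- The parameter pair `p` is optimal for the bilevel problem: minimise `F u` over all
`(λ₁, λ₂) ∈ Λ` and all solutions `u` of the lower level problem with parameters `(λ₁, λ₂)`
(which need not be unique). -/
def IsBilevelOptimal (Ω : Set (EuclideanSpace ℝ (Fin d))) (f : EuclideanSpace ℝ (Fin d) → ℝ)
    (F : (EuclideanSpace ℝ (Fin d) → ℝ) → ℝ≥0∞) (Λ : Set (ℝ × ℝ)) (p : ℝ × ℝ) : Prop :=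
  p ∈ Λ ∧ ∃ u ∈ lowerArgmin Ω f p.1 p.2,
    ∀ q ∈ Λ, ∀ w ∈ lowerArgmin Ω f q.1 q.2, F u ≤ F w

/-- The `L²` cost `‖u - ũ‖²_{L²(Ω)}`. -/
def costL2 (Ω : Set (EuclideanSpace ℝ (Fin d))) (utilde u : EuclideanSpace ℝ (Fin d) → ℝ) :
    ℝ≥0∞ :=
  eLpNorm (fun x => u x - utilde x) 2 (volume.restrict Ω) ^ 2

/-- The radial profile `η_γ` of the vector field `h_γ(z) = η_γ(|z|) z / |z|`, the derivative of the
smooth Huber function `|·|_γ`. -/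
def huberSlope (γ r : ℝ) : ℝ :=
  if 1 / (2 * γ) ≤ γ * r - 1 then 1
  else if γ * r - 1 ≤ -(1 / (2 * γ)) then γ * r
  else 1 - γ / 2 * (1 - γ * r + 1 / (2 * γ)) ^ 2

/-- The smooth Huber function `|z|_γ`: the function with gradient `h_γ` that vanishes at `0`. -/
def huberAbs (γ : ℝ) (z : EuclideanSpace ℝ (Fin d)) : ℝ :=
  ∫ r in (0 : ℝ)..‖z‖, huberSlope γ r

/-- The Huberised total variation `‖Du‖_{M,γ} = ∫_Ω |∇u|_γ dx + |Dˢu|(Ω)` of `u ∈ BV(Ω)`. -/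
def huberTV (Ω : Set (EuclideanSpace ℝ (Fin d))) (γ : ℝ) (u : EuclideanSpace ℝ (Fin d) → ℝ) :
    ℝ≥0∞ :=
  (∫⁻ x in Ω, ENNReal.ofReal (huberAbs γ (acDensity (distribGradient Ω u) x))) +
    (singularPart (distribGradient Ω u)).variation Ω

/-- The Huberised TV cost `‖D(u - ũ)‖_{M,γ}`. -/
def costHuberTV (Ω : Set (EuclideanSpace ℝ (Fin d))) (γ : ℝ)
    (utilde u : EuclideanSpace ℝ (Fin d) → ℝ) : ℝ≥0∞ :=
  huberTV Ω γ fun x => u x - utilde x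

end TVIC

end

/-!
A minimising sequence of the bilevel problem consists of parameters `pₙ`, which converge along a
subsequence to some `q`, and of minimisers `uₙ` of the lower level functionals
`|Du|(Ω) + Φ^{λ₁,λ₂}(u, f)` with `(λ₁, λ₂) = pₙ`, whose costs converge to the infimum.

If both components of `q` are positive, comparison with `u = 0` bounds `|Duₙ|(Ω)` and the fidelity
of `uₙ`, and the fidelity controls the `L¹` norm uniformly for parameters bounded away from zero
(`exists_eLpNorm_one_le`). By compactness of `BV(Ω)` in `L¹(Ω)` a subsequence of `uₙ` converges to
some `v ∈ BV(Ω)`. The fidelity is continuous in the parameters near `q` (`tendsto_fidelity`) and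
Lipschitz in `u` for the `L¹` norm (`fidelity_le_add`), and the total variation is lower
semicontinuous, so `v` minimises the functional for `q` (`mem_lowerArgmin_of_tendsto`). The costs
are lower semicontinuous, so `v` is optimal.

If a component of `q` vanishes, the fidelity of `0` for `pₙ` tends to zero, hence so does
`|Duₙ|(Ω)`. At `q` the fidelity vanishes identically, so every function without variation is a
minimiser, and it is enough to find one whose cost is at most the infimum. For the `L²` cost the
cost itself bounds `uₙ` in `L¹`, and the `L¹` limit of a subsequence will do
(`exists_costL2_le`). The Huberised cost sees `u` only through `Du`, and `Duₙ → 0` as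
distributions, so the zero function will do (`costHuberTV_zero_le`).

The facts about `BV` that this needs are proved from scratch.

* Lower semicontinuity of `|Du|(Ω)` and of `‖Du‖_{M,γ}`: both are suprema of functionals
  `μ ↦ ∫ φ · dμ - ∫_Ω g(|φ|) dx` over test fields `φ` with values in the unit ball, with `g = 0`
  and with `g` the convex conjugate of the Huber profile, respectively. The extremal field is the
  polar of `μ`, on the singular set only in the Huberised case, and it is the almost everywhere
  limit of test fields (`exists_testField_tendsto`).
* Compactness (`exists_subseq_tendsto_L1`): translates of `u` by `a` differ from `u` by at most
  `|a| |Du|(Ω)` in `L¹`, so mollification gives compactness in the interior. Near the boundary, the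
  Lipschitz condition lets pieces of `Ω` be pushed into the interior by small translations, which
  replaces an extension operator.
* Closedness (`isBV_of_tendsto_L1`): the measures `|Dvₙ|` have a weak limit `ν`, which dominates the
  distributional gradient of the limit function; that gradient is then represented by a density
  in `L²(ν)`.
-/

namespace TVIC

open Filter Topology

variable {d : ℕ}

local notation:max "𝔼" d:max => EuclideanSpace ℝ (Fin d)

/-! ### Polar decomposition and Lebesgue decomposition of vector measures -/

section VectorMeasure

variable {X F G H : Type*} [MeasurableSpace X]
  [NormedAddCommGroup F] [NormedSpace ℝ F] [NormedAddCommGroup G] [NormedSpace ℝ G]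
  [NormedAddCommGroup H] [NormedSpace ℝ H] [CompleteSpace F] [CompleteSpace H]

/-- Integration against a vector measure whose density `σ` is bounded by `1`. The bound gives
`|σ m| ≤ m`, so that both sides are continuous in `φ ∈ L¹(m)`. -/
theorem integral_withDensityᵥ_of_norm_le_one {m : Measure X} {σ : X → F} (hσ : Integrable σ m)
    (hσ1 : ∀ᵐ x ∂m, ‖σ x‖ₑ ≤ 1) {φ : X → G} (hφ : Integrable φ m) (B : G →L[ℝ] F →L[ℝ] H) :
    ∫ᵛ x, φ x ∂[B; m.withDensityᵥ σ] = ∫ x, B (φ x) (σ x) ∂m := by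
  have hvar : (m.withDensityᵥ σ).variation ≤ m := by
    rw [Measure.variation_withDensityᵥ hσ]
    exact (withDensity_mono hσ1).trans withDensity_one.le
  have hint : ∀ f : X → G, Integrable f m → Integrable (fun x ↦ B (f x) (σ x)) m := by
    intro f hf
    have hb : Integrable (fun x ↦ ‖B‖ * ‖f x‖) m := hf.norm.const_mul _
    refine hb.mono' (B.aestronglyMeasurable_comp₂ hf.1 hσ.1) ?_
    filter_upwards [hσ1] with x hx
    have hx : ‖σ x‖ ≤ 1 := by simpa [← ofReal_norm] using hx
    calc ‖B (f x) (σ x)‖ ≤ ‖B‖ * ‖f x‖ * ‖σ x‖ := B.le_opNorm₂ _ _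
      _ ≤ ‖B‖ * ‖f x‖ * 1 := by gcongr
      _ = _ := mul_one _
  refine Integrable.induction
    (fun φ ↦ ∫ᵛ x, φ x ∂[B; m.withDensityᵥ σ] = ∫ x, B (φ x) (σ x) ∂m) ?_ ?_ ?_ ?_ hφ
  · intro c s hs hms
    have : IsFiniteMeasure (m.withDensityᵥ σ).variation := by
      constructor
      rw [Measure.variation_withDensityᵥ hσ, withDensity_apply _ .univ, setLIntegral_univ]
      exact hσ.2
    rw [VectorMeasure.integral_indicator hs, VectorMeasure.integral_const]
    rw [VectorMeasure.restrict_apply _ hs .univ, univ_inter, withDensityᵥ_apply hσ hs,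
      ← ContinuousLinearMap.integral_comp_comm _ hσ.integrableOn, ← integral_indicator hs]
    congr 1 with x
    by_cases hx : x ∈ s <;> simp [hx]
  · intro f g hfg hf hg ihf ihg
    simp only [Pi.add_apply, map_add, add_apply]
    rw [VectorMeasure.integral_fun_add (hf.mono_measure hvar) (hg.mono_measure hvar),
      integral_add (hint f hf) (hint g hg), ihf, ihg]
  · refine isClosed_eq (LipschitzWith.continuous (K := ‖B‖₊) fun f g ↦ ?_)
      (LipschitzWith.continuous (K := ‖B‖₊) fun f g ↦ ?_)
    · refine (VectorMeasure.edist_integral_le_lintegral_edist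
        ((L1.integrable_coeFn f).mono_measure hvar) ((L1.integrable_coeFn g).mono_measure hvar)).trans ?_
      rw [L1.edist_def]
      exact mul_le_mul' le_rfl (lintegral_mono' hvar le_rfl)
    · rw [edist_eq_enorm_sub, ← integral_sub (hint f (L1.integrable_coeFn f))
        (hint g (L1.integrable_coeFn g)), L1.edist_def, ← lintegral_const_mul' _ _ (by simp)]
      refine (enorm_integral_le_lintegral_enorm _).trans (lintegral_mono_ae ?_)
      filter_upwards [hσ1] with x hx
      rw [← sub_apply, ← map_sub, edist_eq_enorm_sub]
      calc ‖B (f x - g x) (σ x)‖ₑ ≤ ‖B‖ₑ * ‖f x - g x‖ₑ * ‖σ x‖ₑ := by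
            simp only [← ofReal_norm]
            rw [← ENNReal.ofReal_mul (by positivity), ← ENNReal.ofReal_mul (by positivity)]
            exact ENNReal.ofReal_le_ofReal (B.le_opNorm₂ _ _)
        _ ≤ ‖B‖ₑ * ‖f x - g x‖ₑ * 1 := by gcongr
        _ = _ := mul_one _
  · intro f g hfg hf ih
    rw [← VectorMeasure.integral_congr_ae ((Measure.absolutelyContinuous_of_le hvar).ae_le hfg), ih]
    refine integral_congr_ae ?_
    filter_upwards [hfg] with x hx
    rw [hx]

/-- Integration against a vector measure with density `σ`. Writing `σ m` as the measure with density
`σ / ‖σ‖` with respect to `‖σ‖ m` reduces this to densities bounded by `1`. -/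
theorem integral_withDensityᵥ {m : Measure X} {σ : X → F} (hσ : Integrable σ m)
    {φ : X → G} (hφ : (m.withDensityᵥ σ).Integrable φ) (B : G →L[ℝ] F →L[ℝ] H) :
    ∫ᵛ x, φ x ∂[B; m.withDensityᵥ σ] = ∫ x, B (φ x) (σ x) ∂m := by
  have hm : AEMeasurable (fun x ↦ ‖σ x‖₊) m := hσ.1.nnnorm.aemeasurable
  set τ : X → F := fun x ↦ ‖σ x‖⁻¹ • σ x with hτ
  have h1 : (fun x ↦ ‖σ x‖₊) • τ = σ := by
    ext x
    by_cases h : σ x = 0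
    · simp [hτ, h]
    · simp [hτ, NNReal.smul_def, smul_smul, h]
  have hτi : Integrable τ (m.withDensity fun x ↦ (‖σ x‖₊ : ℝ≥0∞)) := by
    rw [integrable_withDensity_iff_integrable_smul₀ hm]
    change Integrable ((fun x ↦ ‖σ x‖₊) • τ) m
    rwa [h1]
  have h2 : m.withDensityᵥ σ = (m.withDensity fun x ↦ (‖σ x‖₊ : ℝ≥0∞)).withDensityᵥ τ := by
    rw [← withDensityᵥ_smul_eq_withDensityᵥ_withDensity hm (by rwa [h1]), h1]
  rw [VectorMeasure.Integrable, Measure.variation_withDensityᵥ hσ] at hφ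
  rw [h2, integral_withDensityᵥ_of_norm_le_one hτi _ hφ, integral_withDensity_eq_integral_smul₀ hm]
  · congr 1 with x
    rw [NNReal.smul_def, ← map_smul]
    exact congrArg _ (congrFun h1 x)
  · refine ae_of_all _ fun x ↦ ?_
    rw [← ofReal_norm, ENNReal.ofReal_le_one, hτ, norm_smul, norm_inv, norm_norm]
    exact inv_mul_le_one

end VectorMeasure

section Euclidean

variable {X : Type*} [MeasurableSpace X]

/-- The polar decomposition of a finite vector measure. -/
theorem exists_polar {μ : VectorMeasure X 𝔼 d} (hμ : μ.variation univ ≠ ⊤) :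
    ∃ σ : X → 𝔼 d, Measurable σ ∧ Integrable σ μ.variation ∧ (∀ᵐ x ∂μ.variation, ‖σ x‖ = 1) ∧
      μ = μ.variation.withDensityᵥ σ := by
  have : IsFiniteMeasure μ.variation := ⟨hμ.lt_top⟩
  let L (i : Fin d) : 𝔼 d →L[ℝ] ℝ := EuclideanSpace.proj i
  let c (i : Fin d) : SignedMeasure X :=
    μ.mapRange (L i).toLinearMap.toAddMonoidHom (L i).continuous
  have hc : ∀ i, c i ≪ᵥ μ.variation.toENNRealVectorMeasure := by
    intro i
    refine VectorMeasure.AbsolutelyContinuous.mk fun s hs h0 ↦ ?_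
    rw [Measure.toENNRealVectorMeasure_apply_measurable hs] at h0
    have : μ s = 0 := by
      rw [← enorm_eq_zero, ← le_zero_iff, ← h0]
      exact VectorMeasure.enorm_measure_le_variation _ _
    change L i (μ s) = 0
    rw [this, map_zero]
  let σ : X → 𝔼 d := fun x ↦ WithLp.toLp 2 fun i ↦ (c i).rnDeriv μ.variation x
  have hσm : Measurable σ := by
    refine (WithLp.measurable_toLp 2 _).comp (measurable_pi_lambda _ fun i ↦ ?_)
    exact SignedMeasure.measurable_rnDeriv _ _
  have hσi : Integrable σ μ.variation :=
    Integrable.of_eval_piLp fun i ↦ SignedMeasure.integrable_rnDeriv _ _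
  have hμσ : μ = μ.variation.withDensityᵥ σ := by
    ext s hs i
    rw [withDensityᵥ_apply hσi hs]
    have h1 : (∫ x in s, σ x ∂μ.variation) i = ∫ x in s, σ x i ∂μ.variation :=
      ((L i).integral_comp_comm hσi.integrableOn).symm
    rw [h1]
    change c i s = _
    conv_lhs => rw [← SignedMeasure.withDensityᵥ_rnDeriv_eq _ _ (hc i)]
    rw [withDensityᵥ_apply (SignedMeasure.integrable_rnDeriv _ _) hs]
  refine ⟨σ, hσm, hσi, ?_, hμσ⟩
  have h1 := Measure.variation_withDensityᵥ hσi
  rw [← hμσ] at h1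
  have h2 : (fun x ↦ ‖σ x‖ₑ) =ᵐ[μ.variation] fun _ ↦ 1 := by
    refine (withDensity_eq_iff (by fun_prop) (by fun_prop) hσi.2.ne).1 ?_
    rw [← h1]
    exact withDensity_one.symm
  filter_upwards [h2] with x hx
  simpa [← ofReal_norm] using hx

theorem integrable_acDensity (μ : VectorMeasure 𝔼 d 𝔼 d) : Integrable (acDensity μ) :=
  Integrable.of_eval_piLp fun _ ↦ SignedMeasure.integrable_rnDeriv _ _

theorem measurable_acDensity (μ : VectorMeasure 𝔼 d 𝔼 d) : Measurable (acDensity μ) :=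
  (WithLp.measurable_toLp 2 _).comp
    (measurable_pi_lambda _ fun _ ↦ SignedMeasure.measurable_rnDeriv _ _)

theorem withDensityᵥ_acDensity_add_singularPart (μ : VectorMeasure 𝔼 d 𝔼 d) :
    volume.withDensityᵥ (acDensity μ) + singularPart μ = μ := by
  simp [singularPart]

theorem variation_singularPart_ne_top {μ : VectorMeasure 𝔼 d 𝔼 d} (hμ : μ.variation univ ≠ ⊤) :
    (singularPart μ).variation univ ≠ ⊤ := by
  refine ne_top_of_le_ne_top ?_ (VectorMeasure.variation_sub_le (μ := μ)
    (ν := volume.withDensityᵥ (acDensity μ)) univ)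
  rw [Measure.add_apply, Measure.variation_withDensityᵥ (integrable_acDensity μ),
    withDensity_apply _ .univ, setLIntegral_univ]
  exact ENNReal.add_ne_top.2 ⟨hμ, (integrable_acDensity μ).2.ne⟩

theorem singularPart_apply_coord (μ : VectorMeasure 𝔼 d 𝔼 d) {s : Set 𝔼 d} (hs : MeasurableSet s)
    (i : Fin d) : singularPart μ s i = (component μ i).singularPart volume s := by
  have h1 : singularPart μ s = μ s - volume.withDensityᵥ (acDensity μ) s := rfl
  have h2 : (∫ x in s, acDensity μ x) i = ∫ x in s, (component μ i).rnDeriv volume x :=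
    ((EuclideanSpace.proj i : 𝔼 d →L[ℝ] ℝ).integral_comp_comm
      (integrable_acDensity μ).integrableOn).symm
  have h3 := congrArg (fun ν : SignedMeasure 𝔼 d ↦ ν s)
    ((component μ i).singularPart_add_withDensity_rnDeriv_eq volume)
  simp only [add_apply] at h3
  rw [withDensityᵥ_apply (SignedMeasure.integrable_rnDeriv _ _) hs] at h3
  rw [h1, withDensityᵥ_apply (integrable_acDensity μ) hs, PiLp.sub_apply, h2]
  change component μ i s - _ = _
  linarith

/-- The singular part is carried by a Lebesgue null set. -/
theorem exists_null_set_singularPart (μ : VectorMeasure 𝔼 d 𝔼 d) :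
    ∃ N : Set 𝔼 d, MeasurableSet N ∧ volume N = 0 ∧ (singularPart μ).variation Nᶜ = 0 := by
  have h : ∀ i, ∃ N : Set 𝔼 d, MeasurableSet N ∧ volume N = 0 ∧
      ∀ t ⊆ Nᶜ, (component μ i).singularPart volume t = 0 := by
    intro i
    obtain ⟨u, hu, h1, h2⟩ := (component μ i).mutuallySingular_singularPart volume
    refine ⟨uᶜ, hu.compl, ?_, fun t ht ↦ h1 t (by simpa using ht)⟩
    simpa [Measure.toENNRealVectorMeasure_apply_measurable hu.compl] using h2 uᶜ le_rfl
  choose N hNm hN0 hN using h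
  refine ⟨⋃ i, N i, .iUnion hNm, measure_iUnion_null hN0, ?_⟩
  rw [VectorMeasure.variation_apply_eq_zero (MeasurableSet.iUnion hNm).compl]
  intro t ht htm
  ext i
  rw [singularPart_apply_coord μ htm, hN i t (ht.trans (compl_subset_compl.2 (subset_iUnion N i)))]
  rfl

end Euclidean

/-! ### Approximation of bounded fields by test fields -/

section Approximation

/-- The radial retraction onto the closed unit ball. -/
noncomputable def radialRetraction {F : Type*} [NormedAddCommGroup F] [NormedSpace ℝ F] (z : F) : F :=
  (max 1 ‖z‖)⁻¹ • z

variable {F : Type*} [NormedAddCommGroup F] [NormedSpace ℝ F]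

theorem continuous_radialRetraction : Continuous (radialRetraction : F → F) := by
  unfold radialRetraction
  refine Continuous.smul (Continuous.inv₀ (by fun_prop) fun z ↦ ?_) continuous_id
  positivity

theorem norm_radialRetraction_le (z : F) : ‖radialRetraction z‖ ≤ 1 := by
  have h : 0 < max 1 ‖z‖ := by positivity
  rw [radialRetraction, norm_smul, norm_inv, Real.norm_of_nonneg h.le, inv_mul_le_iff₀ h, mul_one]
  exact le_max_right _ _

theorem radialRetraction_eq_self {z : F} (hz : ‖z‖ ≤ 1) : radialRetraction z = z := by
  simp [radialRetraction, max_eq_left hz]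

variable {V : Type*} [NormedAddCommGroup V] [NormedSpace ℝ V] [FiniteDimensional ℝ V]

theorem exists_compact_exhaustion {Ω : Set V} (hΩ : IsOpen Ω) :
    ∃ K : ℕ → Set V, (∀ n, IsCompact (K n)) ∧ (∀ n, K n ⊆ Ω) ∧
      ∀ x ∈ Ω, ∀ᶠ n in atTop, x ∈ K n := by
  obtain ⟨C, hC, hCΩ, hU, hmono⟩ := hΩ.exists_iUnion_isClosed
  refine ⟨fun n ↦ Metric.closedBall 0 n ∩ C n,
    fun n ↦ (isCompact_closedBall 0 (n : ℝ)).inter_right (hC n),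
    fun n ↦ inter_subset_right.trans (hCΩ n), fun x hx ↦ ?_⟩
  rw [← hU, mem_iUnion] at hx
  obtain ⟨n, hn⟩ := hx
  obtain ⟨k, hk⟩ := exists_nat_ge ‖x‖
  filter_upwards [eventually_ge_atTop n, eventually_ge_atTop k] with j hj hj'
  refine ⟨?_, hmono hj hn⟩
  rw [mem_closedBall_zero_iff]
  exact hk.trans (Nat.cast_le.2 hj')

variable [MeasurableSpace V] [BorelSpace V]

/-- A measurable field with values in the closed unit ball is the almost everywhere limit of test
fields with values in the closed unit ball. -/
theorem exists_testField_tendsto {m : Measure V} [IsFiniteMeasure m] {Ω : Set V} (hΩ : IsOpen Ω)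
    (hm : m Ωᶜ = 0) {ψ : V → F} (hψ : AEStronglyMeasurable ψ m) (hψ1 : ∀ᵐ x ∂m, ‖ψ x‖ ≤ 1) :
    ∃ φ : ℕ → V → F, (∀ k, ContDiff ℝ ∞ (φ k)) ∧ (∀ k, HasCompactSupport (φ k)) ∧
      (∀ k, tsupport (φ k) ⊆ Ω) ∧ (∀ k x, ‖φ k x‖ ≤ 1) ∧
      ∀ᵐ x ∂m, Tendsto (fun k ↦ φ k x) atTop (𝓝 (ψ x)) := by
  have hψL : MemLp ψ 1 m := memLp_one_iff_integrable.2 (Integrable.of_bound hψ 1 hψ1)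
  -- continuous approximation, almost everywhere along a subsequence
  have hg : ∀ k : ℕ, ∃ g : V → F, Continuous g ∧ AEStronglyMeasurable g m ∧
      eLpNorm (g - ψ) 1 m ≤ ((k : ℝ≥0∞) + 1)⁻¹ := by
    intro k
    obtain ⟨g, -, h2, h3, h4⟩ := hψL.exists_hasCompactSupport_eLpNorm_sub_le ENNReal.one_ne_top
      (ε := ((k : ℝ≥0∞) + 1)⁻¹) (by simp)
    exact ⟨g, h3, h4.1, by rwa [eLpNorm_sub_comm]⟩
  choose g hgc hgm hgψ using hg
  have hlim : Tendsto (fun k ↦ eLpNorm (g k - ψ) 1 m) atTop (𝓝 0) := by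
    refine tendsto_of_tendsto_of_tendsto_of_le_of_le tendsto_const_nhds ?_ (fun _ ↦ zero_le) hgψ
    have := (tendsto_add_atTop_iff_nat 1).2 ENNReal.tendsto_inv_nat_nhds_zero
    simpa using this
  obtain ⟨ns, -, hns⟩ := (tendstoInMeasure_of_tendsto_eLpNorm one_ne_zero hgm hψ
    hlim).exists_seq_tendsto_ae
  -- cutoffs
  obtain ⟨K, hK, hKΩ, hKx⟩ := exists_compact_exhaustion hΩ
  choose χ hχ1 hχc hχΩ hχI using fun n ↦
    exists_continuousMap_one_of_isCompact_subset_isOpen (hK n) hΩ (hKΩ n)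
  let q : ℕ → V → F := fun k x ↦ χ k x • radialRetraction (g (ns k) x)
  have hqc : ∀ k, Continuous (q k) := fun k ↦
    (χ k).continuous.smul (continuous_radialRetraction.comp (hgc _))
  have hq1 : ∀ k x, ‖q k x‖ ≤ 1 := by
    intro k x
    rw [norm_smul, Real.norm_of_nonneg (hχI k x).1]
    exact mul_le_one₀ (hχI k x).2 (norm_nonneg _) (norm_radialRetraction_le _)
  have hqs : ∀ k, Function.support (q k) ⊆ Function.support (χ k) := fun k x hx h0 ↦
    hx (by simp [q, h0])
  -- smoothing
  let ε : ℕ → ℝ := fun k ↦ 1 / ((k : ℝ) + 1)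
  have hε : ∀ k, 0 < ε k := fun k ↦ Nat.one_div_pos_of_nat
  have hε0 : Tendsto ε atTop (𝓝 0) := tendsto_one_div_add_atTop_nhds_zero_nat
  choose p hp1 hp2 hp3 using fun k ↦
    (hqc k).exists_contDiff_approx ⊤ (ε := fun _ ↦ ε k) continuous_const fun _ ↦ hε k
  have hs : ∀ k, Function.support (fun x ↦ (1 + ε k)⁻¹ • p k x) ⊆ Function.support (χ k) :=
    fun k ↦ (Function.support_const_smul_subset _ _).trans ((hp3 k).trans (hqs k))
  -- the smoothing error may leave the unit ball by `ε k`, which the rescaling compensates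
  refine ⟨fun k x ↦ (1 + ε k)⁻¹ • p k x, fun k ↦ contDiff_const.smul (hp1 k),
    fun k ↦ HasCompactSupport.mono (hχc k) (hs k),
    fun k ↦ (closure_mono (hs k)).trans (hχΩ k), fun k x ↦ ?_, ?_⟩
  · have h1 : 0 < 1 + ε k := by linarith [hε k]
    rw [norm_smul, norm_inv, Real.norm_of_nonneg h1.le, inv_mul_le_iff₀ h1, mul_one]
    have h2 := (hp2 k x).le
    rw [dist_eq_norm] at h2
    calc ‖p k x‖ = ‖q k x + (p k x - q k x)‖ := by congr 1; abel
      _ ≤ ‖q k x‖ + ‖p k x - q k x‖ := norm_add_le _ _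
      _ ≤ 1 + ε k := add_le_add (hq1 k x) h2
  · have hΩae : ∀ᵐ x ∂m, x ∈ Ω := by
      rw [ae_iff]
      exact hm
    filter_upwards [hψ1, hns, hΩae] with x hx1 hx2 hx3
    have hq : Tendsto (fun k ↦ q k x) atTop (𝓝 (ψ x)) := by
      have h1 : Tendsto (fun k ↦ radialRetraction (g (ns k) x)) atTop (𝓝 (ψ x)) := by
        have := (continuous_radialRetraction.tendsto (ψ x)).comp hx2
        rwa [radialRetraction_eq_self hx1] at this
      refine h1.congr' ?_
      filter_upwards [hKx x hx3] with k hk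
      have : χ k x = 1 := hχ1 k hk
      simp [q, this]
    have hp : Tendsto (fun k ↦ p k x) atTop (𝓝 (ψ x)) := by
      refine tendsto_of_tendsto_of_dist hq (squeeze_zero (fun _ ↦ dist_nonneg) (fun k ↦ ?_) hε0)
      rw [dist_comm]
      exact (hp2 k x).le
    have h1 : Tendsto (fun k ↦ (1 + ε k)⁻¹) atTop (𝓝 1) := by
      have := (hε0.const_add 1).inv₀ (by norm_num)
      simpa using this
    simpa using h1.smul hp

end Approximation

/-! ### The Huber profile and its conjugate -/

section Huber

theorem monotone_huberSlope {γ : ℝ} (hγ : 1 / 2 ≤ γ) : Monotone (huberSlope γ) := by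
  have h0 : 0 < γ := by linarith
  intro r r' hr
  have hγr : γ * r ≤ γ * r' := by gcongr
  -- the quadratic piece lives on `-δ < γ r - 1 < δ` and takes the value `1 - δ` at its left end
  obtain ⟨δ, hδ⟩ : ∃ δ, δ = 1 / (2 * γ) := ⟨_, rfl⟩
  have hδ0 : 0 < δ := by rw [hδ]; positivity
  have hγδ : γ * δ = 1 / 2 := by rw [hδ]; field_simp
  unfold huberSlope
  rw [← hδ]
  generalize γ * r = s at *
  generalize γ * r' = s' at *
  have key : ∀ x y : ℝ, 0 ≤ x → x ≤ y → γ / 2 * x ^ 2 ≤ γ / 2 * y ^ 2 := by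
    intro x y hx hxy
    gcongr
  have key2 : γ / 2 * (2 * δ) ^ 2 = δ := by
    calc γ / 2 * (2 * δ) ^ 2 = 2 * (γ * δ) * δ := by ring
      _ = δ := by rw [hγδ]; ring
  split_ifs with h1 h2 h3 h4 h5 h6 h7 h8
  · exact le_rfl
  · linarith
  · linarith
  · linarith
  · exact hγr
  · have := key (1 - s' + δ) (2 * δ) (by linarith) (by linarith)
    linarith
  · have : 0 ≤ γ / 2 * (1 - s + δ) ^ 2 := by positivity
    linarith
  · linarith
  · have := key (1 - s' + δ) (1 - s + δ) (by linarith) (by linarith)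
    linarith

theorem huberSlope_zero {γ : ℝ} (hγ : 1 / 2 ≤ γ) : huberSlope γ 0 = 0 := by
  have h0 : 0 < γ := by linarith
  have h1 : 0 < 1 / (2 * γ) := by positivity
  have h2 : 1 / (2 * γ) ≤ 1 := by rw [div_le_one (by positivity)]; linarith
  rw [huberSlope, if_neg (by linarith), if_pos (by linarith), mul_zero]

/-- The radius beyond which the Huber slope equals `1`. -/
noncomputable def huberRadius (γ : ℝ) : ℝ := (1 + 1 / (2 * γ)) / γ

theorem huberRadius_nonneg {γ : ℝ} (hγ : 1 / 2 ≤ γ) : 0 ≤ huberRadius γ := by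
  have h0 : 0 < γ := by linarith
  unfold huberRadius
  positivity

theorem huberSlope_eq_one {γ : ℝ} (hγ : 1 / 2 ≤ γ) {r : ℝ} (hr : huberRadius γ ≤ r) :
    huberSlope γ r = 1 := by
  have h0 : 0 < γ := by linarith
  rw [huberRadius, div_le_iff₀ h0] at hr
  rw [huberSlope, if_pos (by linarith)]

theorem huberSlope_le_one {γ : ℝ} (hγ : 1 / 2 ≤ γ) (r : ℝ) : huberSlope γ r ≤ 1 := by
  rw [← huberSlope_eq_one hγ (le_max_right r (huberRadius γ))]
  exact monotone_huberSlope hγ (le_max_left _ _)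

theorem huberSlope_nonneg {γ : ℝ} (hγ : 1 / 2 ≤ γ) {r : ℝ} (hr : 0 ≤ r) : 0 ≤ huberSlope γ r := by
  rw [← huberSlope_zero hγ]
  exact monotone_huberSlope hγ hr

/-- The radial profile of the smooth Huber function. -/
noncomputable def huberProfile (γ t : ℝ) : ℝ := ∫ r in (0 : ℝ)..t, huberSlope γ r

theorem continuous_huberProfile {γ : ℝ} (hγ : 1 / 2 ≤ γ) : Continuous (huberProfile γ) :=
  intervalIntegral.continuous_primitive
    (fun _ _ ↦ (monotone_huberSlope hγ).intervalIntegrable) 0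

/-- The subgradient inequality: the Huber profile is convex with derivative `huberSlope γ`. -/
theorem huberProfile_add_slope_mul_le {γ : ℝ} (hγ : 1 / 2 ≤ γ) (t t' : ℝ) :
    huberProfile γ t + huberSlope γ t * (t' - t) ≤ huberProfile γ t' := by
  have hi : ∀ a b, IntervalIntegrable (huberSlope γ) volume a b :=
    fun _ _ ↦ (monotone_huberSlope hγ).intervalIntegrable
  have h1 : huberProfile γ t' = huberProfile γ t + ∫ r in t..t', huberSlope γ r :=
    (intervalIntegral.integral_add_adjacent_intervals (hi _ _) (hi _ _)).symm
  rw [h1]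
  gcongr
  rcases le_total t t' with h | h
  · calc huberSlope γ t * (t' - t) = ∫ _ in t..t', huberSlope γ t := by simp [mul_comm]
      _ ≤ _ := intervalIntegral.integral_mono_on h (by simp) (hi _ _)
        fun r hr ↦ monotone_huberSlope hγ hr.1
  · rw [intervalIntegral.integral_symm]
    have : ∫ r in t'..t, huberSlope γ r ≤ ∫ _ in t'..t, huberSlope γ t :=
      intervalIntegral.integral_mono_on h (hi _ _) (by simp)
        fun r hr ↦ monotone_huberSlope hγ hr.2
    simp only [intervalIntegral.integral_const, smul_eq_mul] at this
    linarith

theorem huberProfile_zero (γ : ℝ) : huberProfile γ 0 = 0 := by simp [huberProfile]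

theorem huberProfile_nonneg {γ : ℝ} (hγ : 1 / 2 ≤ γ) (t : ℝ) : 0 ≤ huberProfile γ t := by
  have := huberProfile_add_slope_mul_le hγ 0 t
  rwa [huberProfile_zero, huberSlope_zero hγ, zero_mul, add_zero] at this

theorem huberProfile_le_self {γ : ℝ} (hγ : 1 / 2 ≤ γ) {t : ℝ} (ht : 0 ≤ t) :
    huberProfile γ t ≤ t := by
  have h1 := huberProfile_add_slope_mul_le hγ t 0
  have h2 := mul_le_mul_of_nonneg_right (huberSlope_le_one hγ t) ht
  rw [huberProfile_zero] at h1
  linarith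

/-- The convex conjugate of the Huber profile on `[0, 1]`; the supremum is attained on the compact
interval `[0, huberRadius γ]`. -/
noncomputable def huberConjugate (γ s : ℝ) : ℝ :=
  sSup ((fun t ↦ s * t - huberProfile γ t) '' Icc 0 (huberRadius γ))

theorem continuous_huberConjugate {γ : ℝ} (hγ : 1 / 2 ≤ γ) : Continuous (huberConjugate γ) := by
  refine isCompact_Icc.continuous_sSup (f := fun s t ↦ s * t - huberProfile γ t) ?_
  have := continuous_huberProfile hγ
  fun_prop

/-- The Fenchel–Young inequality. Beyond the Huber radius the profile has slope `1 ≥ s`, so the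
supremum is not increased there. -/
theorem mul_sub_huberProfile_le {γ : ℝ} (hγ : 1 / 2 ≤ γ) {s t : ℝ} (hs : s ≤ 1) (ht : 0 ≤ t) :
    s * t - huberProfile γ t ≤ huberConjugate γ s := by
  have hc : Continuous fun t ↦ s * t - huberProfile γ t := by
    have := continuous_huberProfile hγ
    fun_prop
  have hb : BddAbove ((fun t ↦ s * t - huberProfile γ t) '' Icc 0 (huberRadius γ)) :=
    (isCompact_Icc.image hc).bddAbove
  rcases le_total t (huberRadius γ) with h | h
  · exact le_csSup hb ⟨t, ⟨ht, h⟩, rfl⟩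
  · refine le_trans ?_ (le_csSup hb ⟨huberRadius γ, ⟨huberRadius_nonneg hγ, le_rfl⟩, rfl⟩)
    have h1 := huberProfile_add_slope_mul_le hγ (huberRadius γ) t
    rw [huberSlope_eq_one hγ le_rfl] at h1
    have h2 : s * (t - huberRadius γ) ≤ 1 * (t - huberRadius γ) := by
      gcongr
    simp only
    linarith

/-- The case of equality in the Fenchel–Young inequality. -/
theorem huberConjugate_slope {γ : ℝ} (hγ : 1 / 2 ≤ γ) {t : ℝ} (ht : 0 ≤ t) :
    huberConjugate γ (huberSlope γ t) = huberSlope γ t * t - huberProfile γ t := by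
  refine le_antisymm (csSup_le ?_ ?_) (mul_sub_huberProfile_le hγ (huberSlope_le_one hγ t) ht)
  · exact (nonempty_Icc.2 (huberRadius_nonneg hγ)).image _
  · rintro _ ⟨t', -, rfl⟩
    have := huberProfile_add_slope_mul_le hγ t t'
    simp only
    linarith

end Huber

/-! ### Test functions and lower semicontinuity of the variation -/

section Pairing

/-- `φ` is a test function (or test field): smooth, with compact support in `Ω`. -/
structure IsTest {F : Type*} [NormedAddCommGroup F] [NormedSpace ℝ F] (Ω : Set 𝔼 d) (φ : 𝔼 d → F) :
    Prop where
  contDiff : ContDiff ℝ ∞ φ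
  hasCompactSupport : HasCompactSupport φ
  tsupport_subset : tsupport φ ⊆ Ω

variable {F G : Type*} [NormedAddCommGroup F] [NormedSpace ℝ F]
  [NormedAddCommGroup G] [NormedSpace ℝ G] {Ω : Set 𝔼 d}

theorem IsTest.eq_zero {φ : 𝔼 d → F} (hφ : IsTest Ω φ) {x : 𝔼 d} (hx : x ∉ Ω) : φ x = 0 :=
  image_eq_zero_of_notMem_tsupport fun h ↦ hx (hφ.tsupport_subset h)

theorem IsTest.integrable {φ : 𝔼 d → F} (hφ : IsTest Ω φ) (m : Measure 𝔼 d) [IsFiniteMeasure m] :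
    Integrable φ m :=
  hφ.contDiff.continuous.integrable_of_hasCompactSupport hφ.hasCompactSupport

theorem IsTest.coord {φ : 𝔼 d → 𝔼 d} (hφ : IsTest Ω φ) (i : Fin d) : IsTest Ω fun x ↦ φ x i :=
  ⟨(EuclideanSpace.proj i : 𝔼 d →L[ℝ] ℝ).contDiff.comp hφ.contDiff,
    hφ.hasCompactSupport.comp_left (g := fun z : 𝔼 d ↦ z i) rfl,
    (closure_mono (Function.support_comp_subset (g := fun z : 𝔼 d ↦ z i) rfl φ)).trans
      hφ.tsupport_subset⟩

theorem enorm_integral_le_variation {H : Type*} [NormedAddCommGroup H] [NormedSpace ℝ H]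
    (hΩ : MeasurableSet Ω) (μ : VectorMeasure 𝔼 d G)
    {φ : 𝔼 d → F} (hφ : ∀ x ∉ Ω, φ x = 0) (hφ1 : ∀ x, ‖φ x‖ ≤ 1) (B : F →L[ℝ] G →L[ℝ] H)
    (hB : ‖B‖ ≤ 1) : ‖∫ᵛ x, φ x ∂[B; μ]‖ₑ ≤ μ.variation Ω := by
  refine VectorMeasure.enorm_integral_le_lintegral_enorm.trans ?_
  calc ‖B‖ₑ * ∫⁻ x, ‖φ x‖ₑ ∂μ.variation ≤ 1 * ∫⁻ x, Ω.indicator 1 x ∂μ.variation := by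
        gcongr with x
        · simpa [← ofReal_norm] using hB
        · by_cases hx : x ∈ Ω
          · simpa [← ofReal_norm, hx] using hφ1 x
          · simp [hφ x hx]
    _ = μ.variation Ω := by rw [one_mul, lintegral_indicator_one hΩ]

theorem norm_innerSL_le_one : ‖(innerSL ℝ : 𝔼 d →L[ℝ] 𝔼 d →L[ℝ] ℝ)‖ ≤ 1 :=
  ContinuousLinearMap.opNorm_le_bound _ zero_le_one fun x ↦ by simp [innerSL_apply_norm]

theorem norm_lsmul_le_one : ‖(ContinuousLinearMap.lsmul ℝ ℝ : ℝ →L[ℝ] 𝔼 d →L[ℝ] 𝔼 d)‖ ≤ 1 :=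
  ContinuousLinearMap.opNorm_lsmul_le

theorem integral_inner_eq_sum {μ : VectorMeasure 𝔼 d 𝔼 d} (hμ : μ.variation univ ≠ ⊤) {φ : 𝔼 d → 𝔼 d}
    (hφ : Integrable φ μ.variation) :
    ∫ᵛ x, φ x ∂[innerSL ℝ; μ] = ∑ i, (∫ᵛ x, φ x i ∂•μ) i := by
  obtain ⟨σ, hσm, hσi, hσ1, hμσ⟩ := exists_polar hμ
  have hσ1' : ∀ᵐ x ∂μ.variation, ‖σ x‖ ≤ 1 := hσ1.mono fun _ h ↦ h.le
  have hφi : ∀ i, Integrable (fun x ↦ φ x i) μ.variation := fun i ↦ hφ.eval_piLp i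
  have h1 : ∫ᵛ x, φ x ∂[innerSL ℝ; μ] = ∫ x, inner ℝ (φ x) (σ x) ∂μ.variation := by
    have := integral_withDensityᵥ hσi (φ := φ) (by rwa [← hμσ]) (innerSL ℝ)
    rwa [← hμσ] at this
  have h2 : ∀ i, (∫ᵛ x, φ x i ∂•μ) i = ∫ x, φ x i * σ x i ∂μ.variation := by
    intro i
    have := integral_withDensityᵥ hσi (φ := fun x ↦ φ x i) (by rw [← hμσ]; exact hφi i)
      (ContinuousLinearMap.lsmul ℝ ℝ)
    rw [← hμσ] at this
    rw [this]
    refine ((EuclideanSpace.proj i : 𝔼 d →L[ℝ] ℝ).integral_comp_comm ?_).symm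
    simp only [ContinuousLinearMap.lsmul_apply]
    exact (hφi i).smul_bdd 1 hσm.aestronglyMeasurable hσ1'
  have h3 : ∀ i, Integrable (fun x ↦ φ x i * σ x i) μ.variation := by
    intro i
    refine (hφi i).mul_bdd (c := 1)
      ((EuclideanSpace.proj i : 𝔼 d →L[ℝ] ℝ).continuous.measurable.comp hσm).aestronglyMeasurable ?_
    filter_upwards [hσ1'] with x hx using (PiLp.norm_apply_le (σ x) i).trans hx
  rw [h1, Finset.sum_congr rfl fun i _ ↦ h2 i, ← integral_finsetSum _ fun i _ ↦ h3 i]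
  refine integral_congr_ae (ae_of_all _ fun x ↦ ?_)
  simp [PiLp.inner_apply, mul_comm]

/-- Convergence of vector measures when tested with scalar test functions in `Ω`. -/
def TestTendsto {ι : Type*} (Ω : Set 𝔼 d) (l : Filter ι) (ν : ι → VectorMeasure 𝔼 d 𝔼 d)
    (μ : VectorMeasure 𝔼 d 𝔼 d) : Prop :=
  ∀ φ : 𝔼 d → ℝ, IsTest Ω φ → Tendsto (fun n ↦ ∫ᵛ x, φ x ∂•(ν n)) l (𝓝 (∫ᵛ x, φ x ∂•μ))

theorem TestTendsto.tendsto_integral_inner {ι : Type*} {l : Filter ι}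
    {ν : ι → VectorMeasure 𝔼 d 𝔼 d} {μ : VectorMeasure 𝔼 d 𝔼 d} (h : TestTendsto Ω l ν μ)
    (hν : ∀ n, (ν n).variation univ ≠ ⊤) (hμ : μ.variation univ ≠ ⊤) {φ : 𝔼 d → 𝔼 d}
    (hφ : IsTest Ω φ) :
    Tendsto (fun n ↦ ∫ᵛ x, φ x ∂[innerSL ℝ; ν n]) l (𝓝 (∫ᵛ x, φ x ∂[innerSL ℝ; μ])) := by
  have key : ∀ ρ : VectorMeasure 𝔼 d 𝔼 d, ρ.variation univ ≠ ⊤ →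
      ∫ᵛ x, φ x ∂[innerSL ℝ; ρ] = ∑ i, (∫ᵛ x, φ x i ∂•ρ) i := by
    intro ρ hρ
    have : IsFiniteMeasure ρ.variation := ⟨hρ.lt_top⟩
    exact integral_inner_eq_sum hρ (hφ.integrable _)
  rw [key μ hμ]
  simp_rw [fun n ↦ key (ν n) (hν n)]
  refine tendsto_finsetSum _ fun i _ ↦ ?_
  exact ((EuclideanSpace.proj i : 𝔼 d →L[ℝ] ℝ).continuous.tendsto _).comp (h _ (hφ.coord i))

end Pairing

section TotalVariation

variable {Ω : Set 𝔼 d}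

/-- The total variation is the supremum of the pairings with test fields bounded by `1`. -/
theorem exists_testField_tendsto_variation (hΩ : IsOpen Ω) {μ : VectorMeasure 𝔼 d 𝔼 d}
    (hμ : μ.variation univ ≠ ⊤) (hμΩ : μ.variation Ωᶜ = 0) :
    ∃ φ : ℕ → 𝔼 d → 𝔼 d, (∀ k, IsTest Ω (φ k)) ∧ (∀ k x, ‖φ k x‖ ≤ 1) ∧
      Tendsto (fun k ↦ ∫ᵛ x, φ k x ∂[innerSL ℝ; μ]) atTop (𝓝 (μ.variation Ω).toReal) := by
  have : IsFiniteMeasure μ.variation := ⟨hμ.lt_top⟩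
  obtain ⟨σ, hσm, hσi, hσ1, hμσ⟩ := exists_polar hμ
  obtain ⟨φ, h1, h2, h3, h4, h5⟩ := exists_testField_tendsto hΩ hμΩ hσm.aestronglyMeasurable
    (hσ1.mono fun _ h ↦ h.le)
  have hT : ∀ k, IsTest Ω (φ k) := fun k ↦ ⟨h1 k, h2 k, h3 k⟩
  refine ⟨φ, hT, h4, ?_⟩
  have h6 : ∀ k, ∫ᵛ x, φ k x ∂[innerSL ℝ; μ] = ∫ x, inner ℝ (φ k x) (σ x) ∂μ.variation := by
    intro k
    have := integral_withDensityᵥ hσi (φ := φ k) (by rw [← hμσ]; exact (hT k).integrable _)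
      (innerSL ℝ)
    rwa [← hμσ] at this
  have h7 : (μ.variation Ω).toReal = ∫ x, inner ℝ (σ x) (σ x) ∂μ.variation := by
    have : ∀ᵐ x ∂μ.variation, inner ℝ (σ x) (σ x) = (1 : ℝ) := by
      filter_upwards [hσ1] with x hx
      rw [real_inner_self_eq_norm_sq, hx, one_pow]
    rw [integral_congr_ae this, integral_const, smul_eq_mul, mul_one, measureReal_def]
    congr 1
    rw [← measure_add_measure_compl hΩ.measurableSet, hμΩ, add_zero]
  simp_rw [h6]
  rw [h7]
  refine tendsto_integral_of_dominated_convergence (fun _ ↦ 1)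
    (fun k ↦ ((h1 k).continuous.aestronglyMeasurable).inner hσm.aestronglyMeasurable)
    (integrable_const _) (fun k ↦ ?_) ?_
  · filter_upwards [hσ1] with x hx
    calc ‖inner ℝ (φ k x) (σ x)‖ ≤ ‖φ k x‖ * ‖σ x‖ := norm_inner_le_norm _ _
      _ ≤ 1 := by rw [hx, mul_one]; exact h4 k x
  · filter_upwards [h5] with x hx
    exact hx.inner tendsto_const_nhds

/-- Lower semicontinuity of the total variation. -/
theorem TestTendsto.eventually_lt_variation {ι : Type*} {l : Filter ι} (hΩ : IsOpen Ω)
    {ν : ι → VectorMeasure 𝔼 d 𝔼 d} {μ : VectorMeasure 𝔼 d 𝔼 d} (h : TestTendsto Ω l ν μ)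
    (hν : ∀ n, (ν n).variation univ ≠ ⊤) (hμ : μ.variation univ ≠ ⊤)
    (hμΩ : μ.variation Ωᶜ = 0) {a : ℝ≥0∞} (ha : a < μ.variation Ω) :
    ∀ᶠ n in l, a < (ν n).variation Ω := by
  obtain ⟨φ, h1, h2, h3⟩ := exists_testField_tendsto_variation hΩ hμ hμΩ
  have hfin : ∀ ρ : VectorMeasure 𝔼 d 𝔼 d, ρ.variation univ ≠ ⊤ → ρ.variation Ω ≠ ⊤ := fun ρ hρ ↦
    ne_top_of_le_ne_top hρ (measure_mono (subset_univ _))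
  have ha' : a.toReal < (μ.variation Ω).toReal := (ENNReal.toReal_lt_toReal ha.ne_top
    (hfin μ hμ)).2 ha
  obtain ⟨k, hk⟩ := (h3.eventually_const_lt ha').exists
  filter_upwards [(h.tendsto_integral_inner hν hμ (h1 k)).eventually_const_lt hk] with n hn
  rw [← ENNReal.toReal_lt_toReal ha.ne_top (hfin _ (hν n))]
  refine hn.trans_le ?_
  rw [← ENNReal.ofReal_le_iff_le_toReal (hfin _ (hν n))]
  refine le_trans ?_ (enorm_integral_le_variation hΩ.measurableSet (ν n)
    (fun x hx ↦ (h1 k).eq_zero hx) (h2 k) (innerSL ℝ) norm_innerSL_le_one)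
  exact Real.ofReal_le_enorm _

end TotalVariation

/-! ### Lower semicontinuity of the Huberised variation -/

section HuberFunctional

/-- The Huberised total variation of a vector measure. -/
noncomputable def huberVariation (Ω : Set (𝔼 d)) (γ : ℝ) (μ : VectorMeasure (𝔼 d) (𝔼 d)) : ℝ≥0∞ :=
  (∫⁻ x in Ω, ENNReal.ofReal (huberAbs γ (acDensity μ x))) + (singularPart μ).variation Ω

/-- The dual functional whose supremum over test fields is the Huberised total variation. -/
noncomputable def huberDual (Ω : Set (𝔼 d)) (γ : ℝ) (μ : VectorMeasure (𝔼 d) (𝔼 d))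
    (φ : 𝔼 d → 𝔼 d) : ℝ :=
  ∫ᵛ x, φ x ∂[innerSL ℝ; μ] - ∫ x in Ω, huberConjugate γ ‖φ x‖

variable {Ω : Set (𝔼 d)} {γ : ℝ} {μ : VectorMeasure (𝔼 d) (𝔼 d)}

theorem integrable_huberAbs_acDensity (hγ : 1 / 2 ≤ γ) (μ : VectorMeasure (𝔼 d) (𝔼 d)) :
    Integrable fun x ↦ huberAbs γ (acDensity μ x) := by
  have hm : Measurable fun x ↦ huberProfile γ ‖acDensity μ x‖ :=
    (continuous_huberProfile hγ).measurable.comp (measurable_acDensity μ).norm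
  refine (integrable_acDensity μ).norm.mono' hm.aestronglyMeasurable (ae_of_all _ fun x ↦ ?_)
  change ‖huberProfile γ ‖acDensity μ x‖‖ ≤ _
  rw [Real.norm_of_nonneg (huberProfile_nonneg hγ _)]
  exact huberProfile_le_self hγ (norm_nonneg _)

theorem huberAbs_nonneg (hγ : 1 / 2 ≤ γ) (z : 𝔼 d) : 0 ≤ huberAbs γ z :=
  huberProfile_nonneg hγ ‖z‖

theorem variation_singularPart_apply_ne_top (hμ : μ.variation univ ≠ ⊤) :
    (singularPart μ).variation Ω ≠ ⊤ :=
  ne_top_of_le_ne_top (variation_singularPart_ne_top hμ) (measure_mono (subset_univ _))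

theorem huberVariation_ne_top (hγ : 1 / 2 ≤ γ) (hμ : μ.variation univ ≠ ⊤) :
    huberVariation Ω γ μ ≠ ⊤ := by
  refine ENNReal.add_ne_top.2 ⟨?_, variation_singularPart_apply_ne_top hμ⟩
  exact (integrable_huberAbs_acDensity hγ μ).integrableOn.lintegral_lt_top.ne

theorem toReal_huberVariation (hγ : 1 / 2 ≤ γ) (hμ : μ.variation univ ≠ ⊤) :
    (huberVariation Ω γ μ).toReal =
      (∫ x in Ω, huberAbs γ (acDensity μ x)) + ((singularPart μ).variation Ω).toReal := by
  rw [huberVariation, ENNReal.toReal_add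
    (integrable_huberAbs_acDensity hγ μ).integrableOn.lintegral_lt_top.ne
    (variation_singularPart_apply_ne_top hμ), integral_eq_lintegral_of_nonneg_ae
    (ae_of_all _ fun x ↦ huberAbs_nonneg hγ _)
    (integrable_huberAbs_acDensity hγ μ).integrableOn.1]

theorem integral_inner_decomposition (hμ : μ.variation univ ≠ ⊤) {φ : 𝔼 d → 𝔼 d}
    (hφ : IsTest Ω φ) :
    ∫ᵛ x, φ x ∂[innerSL ℝ; μ] = (∫ x in Ω, inner ℝ (φ x) (acDensity μ x)) +
      ∫ᵛ x, φ x ∂[innerSL ℝ; singularPart μ] := by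
  have hs : IsFiniteMeasure (singularPart μ).variation :=
    ⟨(variation_singularPart_ne_top hμ).lt_top⟩
  have ha : IsFiniteMeasure (volume.withDensityᵥ (acDensity μ)).variation := by
    constructor
    rw [Measure.variation_withDensityᵥ (integrable_acDensity μ), withDensity_apply _ .univ,
      setLIntegral_univ]
    exact (integrable_acDensity μ).2
  conv_lhs => rw [← withDensityᵥ_acDensity_add_singularPart μ]
  rw [VectorMeasure.integral_add_vectorMeasure (hφ.integrable _) (hφ.integrable _),
    integral_withDensityᵥ (integrable_acDensity μ) (hφ.integrable _)]
  congr 1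
  refine (setIntegral_eq_integral_of_forall_compl_eq_zero fun x hx ↦ ?_).symm
  simp [hφ.eq_zero hx]

theorem integrableOn_huberConjugate (hγ : 1 / 2 ≤ γ) (hΩ : volume Ω ≠ ⊤) {ψ : 𝔼 d → 𝔼 d}
    (hψ : AEStronglyMeasurable ψ (volume.restrict Ω)) (hψ1 : ∀ x, ‖ψ x‖ ≤ 1) :
    IntegrableOn (fun x ↦ huberConjugate γ ‖ψ x‖) Ω ∧
      ∃ C, ∀ s ∈ Icc (0 : ℝ) 1, ‖huberConjugate γ s‖ ≤ C := by
  obtain ⟨C, hC⟩ := isCompact_Icc.exists_bound_of_continuousOn (s := Icc (0 : ℝ) 1)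
    (continuous_huberConjugate hγ).continuousOn
  refine ⟨?_, C, hC⟩
  have : IsFiniteMeasure (volume.restrict Ω) := ⟨by simpa using hΩ.lt_top⟩
  exact Integrable.of_bound ((continuous_huberConjugate hγ).comp_aestronglyMeasurable hψ.norm) C
    (ae_of_all _ fun x ↦ hC _ ⟨norm_nonneg _, hψ1 x⟩)

/-- Weak duality: Fenchel–Young for the density, and `|φ| ≤ 1` for the singular part. -/
theorem huberDual_le (hγ : 1 / 2 ≤ γ) (hΩ : MeasurableSet Ω) (hΩv : volume Ω ≠ ⊤)
    (hμ : μ.variation univ ≠ ⊤) {φ : 𝔼 d → 𝔼 d} (hφ : IsTest Ω φ) (hφ1 : ∀ x, ‖φ x‖ ≤ 1) :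
    huberDual Ω γ μ φ ≤ (huberVariation Ω γ μ).toReal := by
  have hφc := hφ.contDiff.continuous
  have h1 : ∫ᵛ x, φ x ∂[innerSL ℝ; singularPart μ] ≤ ((singularPart μ).variation Ω).toReal := by
    rw [← ENNReal.ofReal_le_iff_le_toReal (variation_singularPart_apply_ne_top hμ)]
    exact (Real.ofReal_le_enorm _).trans (enorm_integral_le_variation hΩ _
      (fun x hx ↦ hφ.eq_zero hx) hφ1 (innerSL ℝ) norm_innerSL_le_one)
  have hi1 : IntegrableOn (fun x ↦ inner ℝ (φ x) (acDensity μ x)) Ω := by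
    refine ((integrable_acDensity μ).norm.mono' (hφc.aestronglyMeasurable.inner
      (integrable_acDensity μ).1) (ae_of_all _ fun x ↦ ?_)).integrableOn
    calc ‖inner ℝ (φ x) (acDensity μ x)‖ ≤ ‖φ x‖ * ‖acDensity μ x‖ := norm_inner_le_norm _ _
      _ ≤ 1 * ‖acDensity μ x‖ := by gcongr; exact hφ1 x
      _ = _ := one_mul _
  have hi2 := (integrableOn_huberConjugate hγ hΩv hφc.aestronglyMeasurable hφ1).1
  rw [huberDual, integral_inner_decomposition hμ hφ, toReal_huberVariation hγ hμ]
  have h2 : (∫ x in Ω, inner ℝ (φ x) (acDensity μ x)) - ∫ x in Ω, huberConjugate γ ‖φ x‖ ≤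
      ∫ x in Ω, huberAbs γ (acDensity μ x) := by
    rw [← integral_sub hi1 hi2]
    refine integral_mono (hi1.sub hi2) (integrable_huberAbs_acDensity hγ μ).integrableOn
      fun x ↦ ?_
    have h3 := mul_sub_huberProfile_le hγ (hφ1 x) (norm_nonneg (acDensity μ x))
    have h4 := real_inner_le_norm (φ x) (acDensity μ x)
    change _ ≤ huberProfile γ ‖acDensity μ x‖
    linarith
  linarith

open Classical in
/-- The Huberised total variation is attained in the limit by the dual functional. The optimal
field is the polar of the singular part on the null set carrying it, and the gradient of the Huber
function at the density elsewhere. -/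
theorem exists_testField_tendsto_huberDual (hγ : 1 / 2 ≤ γ) (hΩ : IsOpen Ω) (hΩv : volume Ω ≠ ⊤)
    (hμ : μ.variation univ ≠ ⊤) :
    ∃ φ : ℕ → 𝔼 d → 𝔼 d, (∀ k, IsTest Ω (φ k)) ∧ (∀ k x, ‖φ k x‖ ≤ 1) ∧
      Tendsto (fun k ↦ huberDual Ω γ μ (φ k)) atTop (𝓝 (huberVariation Ω γ μ).toReal) := by
  have hs : IsFiniteMeasure (singularPart μ).variation :=
    ⟨(variation_singularPart_ne_top hμ).lt_top⟩
  have hv : IsFiniteMeasure (volume.restrict Ω) := ⟨by simpa using hΩv.lt_top⟩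
  obtain ⟨N, hN, hN0, hNs⟩ := exists_null_set_singularPart μ
  obtain ⟨τ, hτm, hτi, hτ1, hτ⟩ := exists_polar (variation_singularPart_ne_top hμ)
  set s := singularPart μ with hs_def
  set a := acDensity μ with ha_def
  have ham : Measurable a := measurable_acDensity μ
  have hai : Integrable a := integrable_acDensity μ
  let p : 𝔼 d → 𝔼 d := fun x ↦ (huberSlope γ ‖a x‖ * ‖a x‖⁻¹) • a x
  have hηm : Measurable (huberSlope γ) := (monotone_huberSlope hγ).measurable
  have hpm : Measurable p :=
    ((hηm.comp ham.norm).mul ham.norm.inv).smul ham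
  have hpn : ∀ x, ‖p x‖ = huberSlope γ ‖a x‖ := by
    intro x
    rw [norm_smul, Real.norm_of_nonneg (mul_nonneg (huberSlope_nonneg hγ (norm_nonneg _))
      (inv_nonneg.2 (norm_nonneg _)))]
    by_cases h : a x = 0
    · simp [h, huberSlope_zero hγ]
    · field_simp
  have hpa : ∀ x, inner ℝ (p x) (a x) - huberConjugate γ ‖p x‖ = huberAbs γ (a x) := by
    intro x
    change _ = huberProfile γ ‖a x‖
    rw [hpn, huberConjugate_slope hγ (norm_nonneg _), real_inner_smul_left,
      real_inner_self_eq_norm_sq]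
    by_cases h : a x = 0
    · simp [h]
    · field_simp
      ring
  let ψ : 𝔼 d → 𝔼 d := N.piecewise τ p
  have hψm : Measurable ψ := hτm.piecewise hN hpm
  have hψs : ∀ᵐ x ∂s.variation, ψ x = τ x := by
    have : ∀ᵐ x ∂s.variation, x ∈ N := by rw [ae_iff]; exact hNs
    filter_upwards [this] with x hx using piecewise_eq_of_mem _ _ _ hx
  have hψv : ∀ᵐ x ∂(volume : Measure (𝔼 d)), ψ x = p x := by
    have : ∀ᵐ x ∂(volume : Measure (𝔼 d)), x ∉ N := by rw [ae_iff]; simpa using hN0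
    filter_upwards [this] with x hx using piecewise_eq_of_notMem _ _ _ hx
  -- convergence is needed both Lebesgue almost everywhere and for the singular part
  let m : Measure (𝔼 d) := volume.restrict Ω + s.variation.restrict Ω
  have hm0 : m Ωᶜ = 0 := by
    simp [m, Measure.restrict_apply hΩ.measurableSet.compl]
  have hψ1 : ∀ᵐ x ∂m, ‖ψ x‖ ≤ 1 := by
    rw [ae_add_measure_iff]
    constructor
    · filter_upwards [ae_restrict_of_ae hψv] with x hx
      rw [hx, hpn]
      exact huberSlope_le_one hγ _
    · filter_upwards [ae_restrict_of_ae hψs, ae_restrict_of_ae hτ1] with x hx hx'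
      rw [hx, hx']
  obtain ⟨φ, h1, h2, h3, h4, h5⟩ := exists_testField_tendsto hΩ hm0 hψm.aestronglyMeasurable hψ1
  have hT : ∀ k, IsTest Ω (φ k) := fun k ↦ ⟨h1 k, h2 k, h3 k⟩
  refine ⟨φ, hT, h4, ?_⟩
  rw [ae_add_measure_iff] at h5
  have hlimv : ∀ᵐ x ∂(volume.restrict Ω), Tendsto (fun k ↦ φ k x) atTop (𝓝 (p x)) := by
    filter_upwards [h5.1, ae_restrict_of_ae hψv] with x hx hx'
    rwa [← hx']
  have hlims : ∀ᵐ x ∂(s.variation.restrict Ω), Tendsto (fun k ↦ φ k x) atTop (𝓝 (τ x)) := by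
    filter_upwards [h5.2, ae_restrict_of_ae hψs] with x hx hx'
    rwa [← hx']
  -- the absolutely continuous term
  have hA : Tendsto (fun k ↦ ∫ x in Ω, inner ℝ (φ k x) (a x)) atTop
      (𝓝 (∫ x in Ω, inner ℝ (p x) (a x))) := by
    refine tendsto_integral_of_dominated_convergence (fun x ↦ ‖a x‖)
      (fun k ↦ ((h1 k).continuous.aestronglyMeasurable).inner ham.aestronglyMeasurable)
      hai.norm.integrableOn (fun k ↦ ae_of_all _ fun x ↦ ?_) ?_
    · calc ‖inner ℝ (φ k x) (a x)‖ ≤ ‖φ k x‖ * ‖a x‖ := norm_inner_le_norm _ _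
        _ ≤ 1 * ‖a x‖ := by gcongr; exact h4 k x
        _ = _ := one_mul _
    · filter_upwards [hlimv] with x hx
      exact hx.inner tendsto_const_nhds
  -- the conjugate term
  have hpn1 : ∀ x, ‖p x‖ ≤ 1 := fun x ↦ (hpn x).trans_le (huberSlope_le_one hγ _)
  obtain ⟨hpi, C, hC⟩ := integrableOn_huberConjugate hγ hΩv hpm.aestronglyMeasurable hpn1
  have hB : Tendsto (fun k ↦ ∫ x in Ω, huberConjugate γ ‖φ k x‖) atTop
      (𝓝 (∫ x in Ω, huberConjugate γ ‖p x‖)) := by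
    refine tendsto_integral_of_dominated_convergence (fun x ↦ C)
      (fun k ↦ ((continuous_huberConjugate hγ).comp
        (h1 k).continuous.norm).aestronglyMeasurable)
      (integrable_const _) (fun k ↦ ae_of_all _ fun x ↦ hC _ ⟨norm_nonneg _, h4 k x⟩) ?_
    filter_upwards [hlimv] with x hx
    exact ((continuous_huberConjugate hγ).tendsto _).comp hx.norm
  -- the singular term
  have h6 : ∀ k, ∫ᵛ x, φ k x ∂[innerSL ℝ; s] = ∫ x in Ω, inner ℝ (φ k x) (τ x) ∂s.variation := by
    intro k
    have := integral_withDensityᵥ hτi (φ := φ k) (by rw [← hτ]; exact (hT k).integrable _)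
      (innerSL ℝ)
    rw [← hτ] at this
    rw [this]
    refine (setIntegral_eq_integral_of_forall_compl_eq_zero fun x hx ↦ ?_).symm
    simp [(hT k).eq_zero hx]
  have hS : Tendsto (fun k ↦ ∫ᵛ x, φ k x ∂[innerSL ℝ; s]) atTop (𝓝 (s.variation Ω).toReal) := by
    have h7 : (s.variation Ω).toReal = ∫ x in Ω, inner ℝ (τ x) (τ x) ∂s.variation := by
      have : ∀ᵐ x ∂(s.variation.restrict Ω), inner ℝ (τ x) (τ x) = (1 : ℝ) := by
        filter_upwards [ae_restrict_of_ae hτ1] with x hx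
        rw [real_inner_self_eq_norm_sq, hx, one_pow]
      rw [integral_congr_ae this, integral_const, smul_eq_mul, mul_one, measureReal_def,
        Measure.restrict_apply_univ]
    simp_rw [h6]
    rw [h7]
    refine tendsto_integral_of_dominated_convergence (fun _ ↦ 1)
      (fun k ↦ ((h1 k).continuous.aestronglyMeasurable).inner hτm.aestronglyMeasurable)
      (integrable_const _) (fun k ↦ ?_) ?_
    · filter_upwards [ae_restrict_of_ae hτ1] with x hx
      calc ‖inner ℝ (φ k x) (τ x)‖ ≤ ‖φ k x‖ * ‖τ x‖ := norm_inner_le_norm _ _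
        _ ≤ 1 := by rw [hx, mul_one]; exact h4 k x
    · filter_upwards [hlims] with x hx
      exact hx.inner tendsto_const_nhds
  have hpai : IntegrableOn (fun x ↦ inner ℝ (p x) (a x)) Ω := by
    refine ((integrable_huberAbs_acDensity hγ μ).integrableOn.add hpi).congr
      (ae_of_all _ fun x ↦ ?_)
    simp only [Pi.add_apply]
    rw [← hpa x]
    ring
  rw [toReal_huberVariation hγ hμ]
  have hlim : ∫ x in Ω, huberAbs γ (acDensity μ x) =
      (∫ x in Ω, inner ℝ (p x) (a x)) - ∫ x in Ω, huberConjugate γ ‖p x‖ := by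
    rw [← integral_sub hpai hpi]
    exact integral_congr_ae (ae_of_all _ fun x ↦ (hpa x).symm)
  rw [hlim]
  refine ((hA.sub hB).add hS).congr fun k ↦ ?_
  rw [huberDual, integral_inner_decomposition hμ (hT k)]
  ring

/-- Lower semicontinuity of the Huberised total variation. -/
theorem TestTendsto.eventually_lt_huberVariation {ι : Type*} {l : Filter ι} (hγ : 1 / 2 ≤ γ)
    (hΩ : IsOpen Ω) (hΩv : volume Ω ≠ ⊤) {ν : ι → VectorMeasure (𝔼 d) (𝔼 d)}
    (h : TestTendsto Ω l ν μ) (hν : ∀ n, (ν n).variation univ ≠ ⊤) (hμ : μ.variation univ ≠ ⊤)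
    {a : ℝ≥0∞} (ha : a < huberVariation Ω γ μ) :
    ∀ᶠ n in l, a < huberVariation Ω γ (ν n) := by
  obtain ⟨φ, h1, h2, h3⟩ := exists_testField_tendsto_huberDual hγ hΩ hΩv hμ
  have ha' := (ENNReal.toReal_lt_toReal ha.ne_top (huberVariation_ne_top hγ hμ)).2 ha
  obtain ⟨k, hk⟩ := (h3.eventually_const_lt ha').exists
  have := (h.tendsto_integral_inner hν hμ (h1 k)).sub_const (∫ x in Ω, huberConjugate γ ‖φ k x‖)
  filter_upwards [this.eventually_const_lt hk] with n hn
  rw [← ENNReal.toReal_lt_toReal ha.ne_top (huberVariation_ne_top hγ (hν n))]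
  exact hn.trans_le (huberDual_le hγ hΩ.measurableSet hΩv (hν n) (h1 k) (h2 k))

end HuberFunctional

/-! ### Translation estimates in `BV` -/

section Translation

variable {Ω V : Set (𝔼 d)} {u : 𝔼 d → ℝ} {μ : VectorMeasure (𝔼 d) (𝔼 d)}

theorem IsTest.comp_sub {F : Type*} [NormedAddCommGroup F] [NormedSpace ℝ F] {φ : 𝔼 d → F}
    (hφ : IsTest V φ) {a : 𝔼 d} (ha : ∀ x ∈ V, x + a ∈ Ω) : IsTest Ω fun y ↦ φ (y - a) := by
  have hs : tsupport (fun y ↦ φ (y - a)) = (Homeomorph.subRight a) ⁻¹' tsupport φ :=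
    tsupport_comp_eq_preimage φ (Homeomorph.subRight a)
  refine ⟨hφ.contDiff.comp (contDiff_id.sub contDiff_const),
    hφ.hasCompactSupport.comp_homeomorph (Homeomorph.subRight a), ?_⟩
  rw [hs]
  intro y hy
  have := ha _ (hφ.tsupport_subset hy)
  simpa using this

theorem gradient_comp_sub (φ : 𝔼 d → ℝ) (a y : 𝔼 d) :
    gradient (fun y ↦ φ (y - a)) y = gradient φ (y - a) := by
  rw [gradient, gradient, fderiv_comp_sub]

theorem IsTest.continuous_gradient {φ : 𝔼 d → ℝ} (hφ : IsTest Ω φ) : Continuous (gradient φ) :=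
  (InnerProductSpace.toDual ℝ (𝔼 d)).symm.continuous.comp
    (hφ.contDiff.continuous_fderiv (by simp))

theorem IsTest.exists_gradient_bound {φ : 𝔼 d → ℝ} (hφ : IsTest Ω φ) :
    ∃ C, ∀ x, ‖gradient φ x‖ ≤ C := by
  refine hφ.continuous_gradient.bounded_above_of_compact_support ?_
  exact (hφ.hasCompactSupport.fderiv ℝ).comp_left (map_zero (InnerProductSpace.toDual ℝ (𝔼 d)).symm)

theorem IsTest.hasDerivAt_comp_sub {φ : 𝔼 d → ℝ} (hφ : IsTest Ω φ) (a y : 𝔼 d) (s : ℝ) :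
    HasDerivAt (fun s : ℝ ↦ φ (y - s • a)) (-inner ℝ (gradient φ (y - s • a)) a) s := by
  have h1 : HasDerivAt (fun s : ℝ ↦ y - s • a) (-((1 : ℝ) • a)) s :=
    ((hasDerivAt_id s).smul_const a).const_sub y
  have h2 := ((hφ.contDiff.differentiable (by simp)) (y - s • a)).hasFDerivAt
  have := h2.comp_hasDerivAt s h1
  refine this.congr_deriv ?_
  rw [map_neg, one_smul]
  simp [gradient]

/-- Correlating `u` with translates of a test function and differentiating along the translation
moves the derivative onto `u`. -/
theorem IsDistribGradient.hasDerivAt_integral (hu : IntegrableOn u Ω)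
    (hμ : IsDistribGradient Ω u μ) {φ : 𝔼 d → ℝ} (hφ : IsTest V φ) {a : 𝔼 d} {s : ℝ}
    (ha : ∀ x ∈ V, x + s • a ∈ Ω) :
    HasDerivAt (fun s : ℝ ↦ ∫ y in Ω, u y * φ (y - s • a))
      (inner ℝ (∫ᵛ y, φ (y - s • a) ∂•μ) a) s := by
  obtain ⟨C, hC⟩ := hφ.exists_gradient_bound
  have hφc := hφ.contDiff.continuous
  have hgc := hφ.continuous_gradient
  have h := (hasDerivAt_integral_of_dominated_loc_of_deriv_le (μ := volume.restrict Ω)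
    (F := fun s y ↦ u y * φ (y - s • a))
    (F' := fun s y ↦ u y * -inner ℝ (gradient φ (y - s • a)) a) (x₀ := s) (s := univ)
    (bound := fun y ↦ ‖u y‖ * (C * ‖a‖)) Filter.univ_mem ?_ ?_ ?_ ?_ ?_ ?_).2
  · refine h.congr_deriv ?_
    have hT := hφ.comp_sub ha
    have h1 := hμ.integral_eq _ hT.contDiff hT.hasCompactSupport hT.tsupport_subset
    have h2 : ∫ᵛ y, φ (y - s • a) ∂•μ = - ∫ y in Ω, u y • gradient φ (y - s • a) := by
      simp_rw [gradient_comp_sub] at h1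
      rw [h1, neg_neg]
    rw [h2, inner_neg_left, real_inner_comm, ← integral_inner, ← integral_neg]
    · refine integral_congr_ae (ae_of_all _ fun y ↦ ?_)
      simp only [real_inner_smul_right, real_inner_comm]
      ring
    · refine hu.smul_bdd C ?_ (ae_of_all _ fun y ↦ hC _)
      exact (hgc.comp (continuous_id.sub continuous_const)).aestronglyMeasurable
  · refine Eventually.of_forall fun t ↦ hu.1.mul ?_
    exact (hφc.comp (continuous_id.sub continuous_const)).aestronglyMeasurable
  · obtain ⟨D, hD⟩ := hφc.bounded_above_of_compact_support hφ.hasCompactSupport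
    refine hu.mul_bdd (c := D) ?_ (ae_of_all _ fun y ↦ hD _)
    exact (hφc.comp (continuous_id.sub continuous_const)).aestronglyMeasurable
  · refine hu.1.mul ?_
    have : Continuous fun y ↦ -inner ℝ (gradient φ (y - s • a)) a := by fun_prop
    exact this.aestronglyMeasurable
  · refine ae_of_all _ fun y t _ ↦ ?_
    rw [norm_mul, norm_neg]
    gcongr
    exact (norm_inner_le_norm _ _).trans (by gcongr; exact hC _)
  · exact hu.norm.mul_const _
  · exact ae_of_all _ fun y t _ ↦ (hφ.hasDerivAt_comp_sub a y t).const_mul (u y)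

theorem IsDistribGradient.variation_eq (hμ : IsDistribGradient Ω u μ) (hΩ : MeasurableSet Ω) :
    μ.variation univ = μ.variation Ω := by
  rw [← measure_add_measure_compl hΩ, hμ.concentrated, add_zero]

theorem norm_integral_lsmul_le (hΩ : MeasurableSet Ω) (hμ : μ.variation univ ≠ ⊤) {φ : 𝔼 d → ℝ}
    (hφ : IsTest Ω φ) (hφ1 : ∀ x, ‖φ x‖ ≤ 1) :
    ‖∫ᵛ y, φ y ∂•μ‖ ≤ (μ.variation Ω).toReal := by
  rw [← toReal_enorm]
  exact ENNReal.toReal_mono (ne_top_of_le_ne_top hμ (measure_mono (subset_univ _)))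
    (enorm_integral_le_variation hΩ μ (fun x hx ↦ hφ.eq_zero hx) hφ1 _ norm_lsmul_le_one)

/-- The `L¹` norm is bounded by a duality with test functions. -/
theorem lintegral_enorm_le_of_forall_isTest (hV : IsOpen V) (hVv : volume V ≠ ⊤) {g : 𝔼 d → ℝ}
    (hg : IntegrableOn g V) {B : ℝ}
    (h : ∀ φ : 𝔼 d → ℝ, IsTest V φ → (∀ x, ‖φ x‖ ≤ 1) → ∫ x in V, g x * φ x ≤ B) :
    ∫⁻ x in V, ‖g x‖ₑ ≤ ENNReal.ofReal B := by
  have hv : IsFiniteMeasure (volume.restrict V) := ⟨by simpa using hVv.lt_top⟩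
  have hψm : AEStronglyMeasurable (fun x ↦ g x * ‖g x‖⁻¹) (volume.restrict V) :=
    (hg.1.aemeasurable.mul hg.1.aemeasurable.norm.inv).aestronglyMeasurable
  have hψ1 : ∀ x, ‖g x * ‖g x‖⁻¹‖ ≤ 1 := fun x ↦ by
    rw [norm_mul, norm_inv, norm_norm]
    exact mul_inv_le_one
  obtain ⟨φ, h1, h2, h3, h4, h5⟩ := exists_testField_tendsto hV
    (m := volume.restrict V) (by simp [Measure.restrict_apply hV.measurableSet.compl]) hψm
    (ae_of_all _ hψ1)
  have hlim : Tendsto (fun k ↦ ∫ x in V, g x * φ k x) atTop (𝓝 (∫ x in V, ‖g x‖)) := by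
    refine tendsto_integral_of_dominated_convergence (fun x ↦ ‖g x‖)
      (fun k ↦ hg.1.mul (h1 k).continuous.aestronglyMeasurable) hg.norm
      (fun k ↦ ae_of_all _ fun x ↦ ?_) ?_
    · rw [norm_mul]
      exact mul_le_of_le_one_right (norm_nonneg _) (h4 k x)
    · filter_upwards [h5] with x hx
      have h6 : ‖g x‖ = g x * (g x * ‖g x‖⁻¹) := by
        by_cases h0 : g x = 0
        · simp [h0]
        · rw [← mul_assoc, ← abs_mul_abs_self (g x), ← Real.norm_eq_abs, mul_assoc,
            mul_inv_cancel₀ (norm_ne_zero_iff.2 h0), mul_one]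
      rw [h6]
      exact hx.const_mul _
  rw [← ofReal_integral_norm_eq_lintegral_enorm hg]
  exact ENNReal.ofReal_le_ofReal
    (le_of_tendsto' hlim fun k ↦ h _ ⟨h1 k, h2 k, h3 k⟩ (h4 k))

theorem integrableOn_comp_add_right (hu : IntegrableOn u Ω) {a : 𝔼 d} (ha : ∀ x ∈ V, x + a ∈ Ω) :
    IntegrableOn (fun x ↦ u (x + a)) V :=
  (((measurePreserving_add_right volume a).integrableOn_comp_preimage
    (measurableEmbedding_addRight a)).2 hu).mono_set ha

/-- Translations of a `BV` function are controlled by its total variation. -/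
theorem IsDistribGradient.lintegral_enorm_translate_sub_le (hΩ : IsOpen Ω) (hV : IsOpen V)
    (hVv : volume V ≠ ⊤) (hu : IntegrableOn u Ω) (hμ : IsDistribGradient Ω u μ) {a : 𝔼 d}
    (ha : ∀ x ∈ V, ∀ s ∈ Icc (0 : ℝ) 1, x + s • a ∈ Ω) :
    ∫⁻ x in V, ‖u (x + a) - u x‖ₑ ≤ ‖a‖ₑ * μ.variation Ω := by
  have hV0 : V ⊆ Ω := fun x hx ↦ by simpa using ha x hx 0 (by simp)
  have hV1 : ∀ x ∈ V, x + a ∈ Ω := fun x hx ↦ by simpa using ha x hx 1 (by simp)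
  have hμΩ : μ.variation Ω ≠ ⊤ := ne_top_of_le_ne_top hμ.finite (measure_mono (subset_univ _))
  have hi0 : IntegrableOn u V := hu.mono_set hV0
  have hi1 : IntegrableOn (fun x ↦ u (x + a)) V := integrableOn_comp_add_right hu hV1
  have hB : ‖a‖ₑ * μ.variation Ω = ENNReal.ofReal (‖a‖ * (μ.variation Ω).toReal) := by
    rw [ENNReal.ofReal_mul (norm_nonneg _), ofReal_norm, ENNReal.ofReal_toReal hμΩ]
  rw [hB]
  refine lintegral_enorm_le_of_forall_isTest hV hVv (hi1.sub hi0) fun φ hφ hφ1 ↦ ?_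
  have hφm : AEStronglyMeasurable φ (volume.restrict V) :=
    hφ.contDiff.continuous.aestronglyMeasurable
  -- the tested difference is an increment of the function `s ↦ ∫ u(y) φ(y - s a) dy`
  have hG0 : ∫ x in V, u x * φ x = ∫ y in Ω, u y * φ (y - (0 : ℝ) • a) := by
    simp only [zero_smul, sub_zero]
    exact setIntegral_eq_of_subset_of_forall_sdiff_eq_zero hΩ.measurableSet hV0
      (fun x hx ↦ by rw [hφ.eq_zero hx.2, mul_zero]) |>.symm
  have hG1 : ∫ x in V, u (x + a) * φ x = ∫ y in Ω, u y * φ (y - (1 : ℝ) • a) := by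
    rw [setIntegral_eq_integral_of_forall_compl_eq_zero fun x hx ↦ by
        rw [hφ.eq_zero hx, mul_zero],
      setIntegral_eq_integral_of_forall_compl_eq_zero fun y hy ↦ by
        rw [hφ.eq_zero (x := y - (1 : ℝ) • a) fun h ↦ hy (by simpa using hV1 _ h), mul_zero],
      ← integral_add_right_eq_self (fun y ↦ u y * φ (y - (1 : ℝ) • a)) a]
    simp
  have hinc := norm_image_sub_le_of_norm_deriv_le_segment_01'
    (f := fun s : ℝ ↦ ∫ y in Ω, u y * φ (y - s • a)) (C := ‖a‖ * (μ.variation Ω).toReal)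
    (fun s hs ↦ (hμ.hasDerivAt_integral hu hφ fun x hx ↦ ha x hx s hs).hasDerivWithinAt)
    fun s hs ↦ by
      have hT : IsTest Ω fun y ↦ φ (y - s • a) :=
        hφ.comp_sub fun x hx ↦ ha x hx s ⟨hs.1, hs.2.le⟩
      refine (norm_inner_le_norm _ _).trans ?_
      rw [mul_comm]
      gcongr
      exact norm_integral_lsmul_le hΩ.measurableSet hμ.finite hT fun x ↦ hφ1 _
  simp only [Pi.sub_apply, sub_mul]
  rw [integral_sub (hi1.mul_bdd hφm (ae_of_all _ hφ1)) (hi0.mul_bdd hφm (ae_of_all _ hφ1)),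
    hG0, hG1]
  exact (le_abs_self _).trans hinc

end Translation

/-! ### Mollification -/

section Mollification

variable {Ω V : Set (𝔼 d)} {u : 𝔼 d → ℝ} {μ : VectorMeasure (𝔼 d) (𝔼 d)}

/-- A mollifier at scale `ε`. -/
structure IsMollifier (ε : ℝ) (ρ : 𝔼 d → ℝ) : Prop where
  continuous : Continuous ρ
  hasCompactSupport : HasCompactSupport ρ
  nonneg : ∀ x, 0 ≤ ρ x
  eq_zero : ∀ x, ε ≤ ‖x‖ → ρ x = 0
  integral_eq_one : ∫ x, ρ x = 1

theorem exists_isMollifier {ε : ℝ} (hε : 0 < ε) : ∃ ρ : 𝔼 d → ℝ, IsMollifier ε ρ := by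
  let b : ContDiffBump (0 : 𝔼 d) := ⟨ε / 2, ε, by positivity, by linarith⟩
  refine ⟨b.normed volume, b.continuous_normed, b.hasCompactSupport_normed, b.nonneg_normed,
    fun x hx ↦ ?_, b.integral_normed⟩
  have : x ∉ Function.support (b.normed volume) := by
    rw [b.support_normed_eq]
    simpa using hx
  simpa using this

/-- The mollification of `u` restricted to `Ω`. -/
noncomputable def mollify (Ω : Set (𝔼 d)) (ρ u : 𝔼 d → ℝ) (x : 𝔼 d) : ℝ :=
  ∫ y in Ω, ρ (y - x) * u y

variable {ε : ℝ} {ρ : 𝔼 d → ℝ}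

theorem IsMollifier.integrableOn_mul (hρ : IsMollifier ε ρ) (hu : IntegrableOn u Ω) (x : 𝔼 d) :
    IntegrableOn (fun y ↦ ρ (y - x) * u y) Ω := by
  obtain ⟨M, hM⟩ := hρ.continuous.bounded_above_of_compact_support hρ.hasCompactSupport
  exact hu.bdd_mul (c := M) (hρ.continuous.comp (continuous_sub_right x)).aestronglyMeasurable
    (ae_of_all _ fun y ↦ hM _)

theorem IsMollifier.measurable_mollify (hρ : IsMollifier ε ρ) (hu : Measurable u) :
    Measurable (mollify Ω ρ u) := by
  have : StronglyMeasurable fun p : (𝔼 d) × (𝔼 d) ↦ ρ (p.2 - p.1) * u p.2 :=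
    ((hρ.continuous.measurable.comp (measurable_snd.sub measurable_fst)).mul
      (hu.comp measurable_snd)).stronglyMeasurable
  exact this.integral_prod_right'.measurable

theorem IsMollifier.mollify_sub_eq (hρ : IsMollifier ε ρ) (hu : IntegrableOn u Ω) {x : 𝔼 d}
    (hx : ∀ y, dist y x < ε → y ∈ Ω) :
    mollify Ω ρ u x - u x = ∫ h, ρ h * (u (x + h) - u x) := by
  have h0 : ∀ y ∉ Ω, ρ (y - x) * u y = 0 := fun y hy ↦ by
    rw [hρ.eq_zero, zero_mul]
    rw [← dist_eq_norm]
    exact not_lt.1 fun h ↦ hy (hx y h)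
  have h1 : mollify Ω ρ u x = ∫ h, ρ h * u (x + h) := by
    rw [mollify, setIntegral_eq_integral_of_forall_compl_eq_zero h0,
      ← integral_add_left_eq_self (fun y ↦ ρ (y - x) * u y) x]
    simp
  have h2 : Integrable fun h ↦ ρ h * u (x + h) := by
    have h3 : Integrable fun y ↦ ρ (y - x) * u y :=
      (integrableOn_iff_integrable_of_support_subset fun y hy ↦
        by_contra fun hy' ↦ hy (h0 y hy')).1 (hρ.integrableOn_mul hu x)
    simpa using h3.comp_add_left x
  have h4 : Integrable fun h ↦ ρ h * u x :=
    (hρ.continuous.integrable_of_hasCompactSupport hρ.hasCompactSupport).mul_const _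
  simp_rw [mul_sub]
  rw [integral_sub h2 h4, integral_mul_const, hρ.integral_eq_one, one_mul, h1]

/-- A `BV` function is close to its mollifications in `L¹`. -/
theorem IsMollifier.lintegral_enorm_mollify_sub_le (hρ : IsMollifier ε ρ)
    (hΩ : IsOpen Ω) (hV : IsOpen V) (hVv : volume V ≠ ⊤) (hum : Measurable u)
    (hu : IntegrableOn u Ω) (hμ : IsDistribGradient Ω u μ)
    (hVΩ : ∀ x ∈ V, ∀ y, dist y x < ε → y ∈ Ω) :
    ∫⁻ x in V, ‖mollify Ω ρ u x - u x‖ₑ ≤ ENNReal.ofReal ε * μ.variation Ω := by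
  have hv : IsFiniteMeasure (volume.restrict V) := ⟨by simpa using hVv.lt_top⟩
  calc ∫⁻ x in V, ‖mollify Ω ρ u x - u x‖ₑ
      ≤ ∫⁻ x in V, ∫⁻ h, ‖ρ h‖ₑ * ‖u (x + h) - u x‖ₑ := by
        refine setLIntegral_mono' hV.measurableSet fun x hx ↦ ?_
        rw [hρ.mollify_sub_eq hu (hVΩ x hx)]
        refine (enorm_integral_le_lintegral_enorm _).trans_eq ?_
        simp_rw [enorm_mul]
    _ = ∫⁻ h, ∫⁻ x in V, ‖ρ h‖ₑ * ‖u (x + h) - u x‖ₑ := by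
        refine lintegral_lintegral_swap (Measurable.aemeasurable ?_)
        exact (hρ.continuous.measurable.comp measurable_snd).enorm.mul
          ((hum.comp (measurable_fst.add measurable_snd)).sub (hum.comp measurable_fst)).enorm
    _ ≤ ∫⁻ h, ‖ρ h‖ₑ * (ENNReal.ofReal ε * μ.variation Ω) := by
        refine lintegral_mono fun h ↦ ?_
        rw [lintegral_const_mul' _ _ enorm_ne_top]
        by_cases hh : ε ≤ ‖h‖
        · simp [hρ.eq_zero h hh]
        · push Not at hh
          gcongr
          refine (hμ.lintegral_enorm_translate_sub_le hΩ hV hVv hu (a := h)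
            fun x hx s hs ↦ hVΩ x hx _ ?_).trans ?_
          · rw [dist_eq_norm, add_sub_cancel_left, norm_smul, Real.norm_of_nonneg hs.1]
            exact (mul_le_of_le_one_left (norm_nonneg _) hs.2).trans_lt hh
          · gcongr
            rw [← ofReal_norm]
            exact ENNReal.ofReal_le_ofReal hh.le
    _ = ENNReal.ofReal ε * μ.variation Ω := by
        have h1 : ∫⁻ h, ‖ρ h‖ₑ = 1 := by
          rw [← ofReal_integral_norm_eq_lintegral_enorm
            (hρ.continuous.integrable_of_hasCompactSupport hρ.hasCompactSupport)]
          simp_rw [fun h ↦ Real.norm_of_nonneg (hρ.nonneg h)]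
          rw [hρ.integral_eq_one, ENNReal.ofReal_one]
        rw [lintegral_mul_const _ hρ.continuous.measurable.enorm, h1, one_mul]

theorem norm_mollify_sub_le {u : 𝔼 d → ℝ} {C δ : ℝ} (hδ : 0 ≤ δ) (hρ : IsMollifier ε ρ)
    (hu : IntegrableOn u Ω) (hC : ∫ x in Ω, ‖u x‖ ≤ C)
    {x x' : 𝔼 d} (hx : ∀ y, ‖ρ (y - x) - ρ (y - x')‖ ≤ δ) :
    ‖mollify Ω ρ u x - mollify Ω ρ u x'‖ ≤ δ * C := by
  rw [mollify, mollify, ← integral_sub (hρ.integrableOn_mul hu x) (hρ.integrableOn_mul hu x')]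
  calc _ ≤ ∫ y in Ω, δ * ‖u y‖ := by
        refine norm_integral_le_of_norm_le (hu.norm.const_mul _) (ae_of_all _ fun y ↦ ?_)
        rw [← sub_mul, norm_mul]
        gcongr
        exact hx y
    _ ≤ δ * C := by rw [integral_const_mul]; gcongr

theorem norm_mollify_le {u : 𝔼 d → ℝ} {C M : ℝ} (hM0 : 0 ≤ M)
    (hu : IntegrableOn u Ω) (hC : ∫ x in Ω, ‖u x‖ ≤ C) (hM : ∀ y, ‖ρ y‖ ≤ M) (x : 𝔼 d) :
    ‖mollify Ω ρ u x‖ ≤ M * C := by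
  rw [mollify]
  calc _ ≤ ∫ y in Ω, M * ‖u y‖ := by
        refine norm_integral_le_of_norm_le (hu.norm.const_mul _) (ae_of_all _ fun y ↦ ?_)
        rw [norm_mul]
        gcongr
        exact hM _
    _ ≤ M * C := by rw [integral_const_mul]; gcongr

/-- Mollifications of an `L¹` bounded sequence are uniformly Cauchy on compact sets along an
ultrafilter. -/
theorem eventually_forall_norm_mollify_sub_le {K : Set (𝔼 d)} (hK : IsCompact K)
    (hρ : IsMollifier ε ρ) {u : ℕ → 𝔼 d → ℝ} {C : ℝ} (hu : ∀ n, IntegrableOn (u n) Ω)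
    (hC : ∀ n, ∫ x in Ω, ‖u n x‖ ≤ C) (U : Ultrafilter ℕ) {δ : ℝ} (hδ : 0 < δ) :
    ∀ᶠ p : ℕ × ℕ in (U : Filter ℕ) ×ˢ (U : Filter ℕ), ∀ x ∈ K,
      ‖mollify Ω ρ (u p.1) x - mollify Ω ρ (u p.2) x‖ ≤ δ := by
  have hC0 : 0 ≤ C := (integral_nonneg fun x ↦ norm_nonneg (u 0 x)).trans (hC 0)
  obtain ⟨M, hM⟩ := hρ.continuous.bounded_above_of_compact_support hρ.hasCompactSupport
  have hM0 : 0 ≤ M := (norm_nonneg _).trans (hM 0)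
  have hδ' : 0 < δ / (3 * (C + 1)) := by positivity
  have hunif := hρ.continuous.uniformContinuous_of_tendsto_cocompact
    hρ.hasCompactSupport.is_zero_at_infty
  obtain ⟨η, hη, hρη⟩ := Metric.uniformContinuous_iff.1 hunif _ hδ'
  obtain ⟨t, -, ht, hKt⟩ := hK.finite_cover_balls hη
  have hlim : ∀ x, ∀ᶠ p : ℕ × ℕ in (U : Filter ℕ) ×ˢ (U : Filter ℕ),
      ‖mollify Ω ρ (u p.1) x - mollify Ω ρ (u p.2) x‖ < δ / 3 := by
    intro x
    obtain ⟨l, -, hl⟩ := (isCompact_closedBall (0 : ℝ) (M * C)).ultrafilter_le_nhds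
      (U.map fun n ↦ mollify Ω ρ (u n) x) (by
        rw [le_principal_iff]
        refine Filter.mem_map.2 (Filter.univ_mem' fun n ↦ mem_closedBall_zero_iff.2 ?_)
        exact norm_mollify_le hM0 (hu n) (hC n) hM x)
    have hl' : Tendsto (fun n ↦ mollify Ω ρ (u n) x) U (𝓝 l) := hl
    have := (hl'.comp tendsto_fst).dist (hl'.comp (tendsto_snd (f := (U : Filter ℕ))))
    rw [dist_self] at this
    filter_upwards [this.eventually_lt_const (show 0 < δ / 3 by positivity)] with p hp
    rwa [← dist_eq_norm]
  filter_upwards [(eventually_all_finite ht).2 fun x _ ↦ hlim x] with p hp x hx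
  obtain ⟨z, hz, hxz⟩ := mem_iUnion₂.1 (hKt hx)
  have h1 : ∀ n, ‖mollify Ω ρ (u n) x - mollify Ω ρ (u n) z‖ ≤ δ / 3 := by
    intro n
    refine (norm_mollify_sub_le hδ'.le hρ (hu n) (hC n) fun y ↦ ?_).trans ?_
    · rw [← dist_eq_norm]
      refine (hρη ?_).le
      rw [dist_sub_left]
      exact hxz
    · rw [div_mul_eq_mul_div, div_le_div_iff₀ (by positivity) (by positivity)]
      nlinarith
  have h2 := h1 p.1
  have h3 := h1 p.2
  have h4 := (hp z hz).le
  calc _ = ‖(mollify Ω ρ (u p.1) x - mollify Ω ρ (u p.1) z) +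
        (mollify Ω ρ (u p.1) z - mollify Ω ρ (u p.2) z) -
        (mollify Ω ρ (u p.2) x - mollify Ω ρ (u p.2) z)‖ := by congr 1; ring
    _ ≤ _ := (norm_sub_le _ _).trans (add_le_add (norm_add_le _ _) le_rfl)
    _ ≤ δ := by linarith

end Mollification

/-! ### Compactness up to the boundary -/

section Compactness

/-- The sequence `u` is Cauchy in `L¹(V)` along the ultrafilter `U`. -/
def CauchyInL1On (U : Ultrafilter ℕ) (u : ℕ → 𝔼 d → ℝ) (V : Set (𝔼 d)) : Prop :=
  ∀ δ : ℝ, 0 < δ → ∀ᶠ p : ℕ × ℕ in (U : Filter ℕ) ×ˢ (U : Filter ℕ),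
    ∫⁻ x in V, ‖u p.1 x - u p.2 x‖ₑ ≤ ENNReal.ofReal δ

variable {Ω V W : Set (𝔼 d)} {U : Ultrafilter ℕ} {u : ℕ → 𝔼 d → ℝ}

theorem CauchyInL1On.mono (h : CauchyInL1On U u W) (hVW : V ⊆ W) : CauchyInL1On U u V :=
  fun δ hδ ↦ (h δ hδ).mono fun _ hp ↦ (lintegral_mono_set hVW).trans hp

theorem CauchyInL1On.union (h : CauchyInL1On U u V) (h' : CauchyInL1On U u W) :
    CauchyInL1On U u (V ∪ W) := by
  intro δ hδ
  filter_upwards [h (δ / 2) (by positivity), h' (δ / 2) (by positivity)] with p hp hp'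
  refine (lintegral_union_le _ _ _).trans ((add_le_add hp hp').trans ?_)
  rw [← ENNReal.ofReal_add (by positivity) (by positivity), add_halves]

/-- A sequence of `BV` functions in `Ω` with uniformly bounded `BV` norms. The functions are
measurable on the whole space, so that their translates are measurable too. -/
structure IsBoundedBVSeq (Ω : Set (𝔼 d)) (u : ℕ → 𝔼 d → ℝ)
    (μ : ℕ → VectorMeasure (𝔼 d) (𝔼 d)) (C : ℝ) : Prop where
  measurable : ∀ n, Measurable (u n)
  integrableOn : ∀ n, IntegrableOn (u n) Ω
  isDistribGradient : ∀ n, IsDistribGradient Ω (u n) (μ n)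
  integral_norm_le : ∀ n, ∫ x in Ω, ‖u n x‖ ≤ C
  variation_le : ∀ n, (μ n).variation Ω ≤ ENNReal.ofReal C

variable {μ : ℕ → VectorMeasure (𝔼 d) (𝔼 d)} {C : ℝ}

theorem IsBoundedBVSeq.nonneg (h : IsBoundedBVSeq Ω u μ C) : 0 ≤ C :=
  (integral_nonneg fun x ↦ norm_nonneg (u 0 x)).trans (h.integral_norm_le 0)

/-- Interior compactness. -/
theorem IsBoundedBVSeq.cauchyInL1On_of_interior (h : IsBoundedBVSeq Ω u μ C) (hΩ : IsOpen Ω)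
    (hV : IsOpen V) (hVb : Bornology.IsBounded V) {ε₀ : ℝ} (hε₀ : 0 < ε₀)
    (hVΩ : ∀ x ∈ V, ∀ y, dist y x < ε₀ → y ∈ Ω) : CauchyInL1On U u V := by
  intro δ hδ
  have hC0 := h.nonneg
  have hVv : volume V ≠ ⊤ := hVb.measure_lt_top.ne
  set v := (volume V).toReal with hv_def
  have hv0 : 0 ≤ v := ENNReal.toReal_nonneg
  have hε' : 0 < δ / (3 * (C + 1)) := by positivity
  have hε : 0 < min ε₀ (δ / (3 * (C + 1))) := lt_min hε₀ hε'
  set ε := min ε₀ (δ / (3 * (C + 1))) with hε_def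
  obtain ⟨ρ, hρ⟩ := exists_isMollifier (d := d) hε
  have h1 : ∀ n, ∫⁻ x in V, ‖mollify Ω ρ (u n) x - u n x‖ₑ ≤ ENNReal.ofReal (δ / 3) := by
    intro n
    refine (hρ.lintegral_enorm_mollify_sub_le hΩ hV hVv (h.measurable n) (h.integrableOn n)
      (h.isDistribGradient n) fun x hx y hy ↦ hVΩ x hx y (hy.trans_le (min_le_left _ _))).trans ?_
    refine (mul_le_mul' le_rfl (h.variation_le n)).trans ?_
    rw [← ENNReal.ofReal_mul hε.le]
    refine ENNReal.ofReal_le_ofReal ?_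
    calc ε * C ≤ δ / (3 * (C + 1)) * C := by gcongr; exact min_le_right _ _
      _ ≤ δ / 3 := by
        rw [div_mul_eq_mul_div, div_le_div_iff₀ (by positivity) (by positivity)]
        nlinarith
  have hδ' : 0 < δ / (3 * (v + 1)) := by positivity
  filter_upwards [eventually_forall_norm_mollify_sub_le hVb.isCompact_closure hρ
    h.integrableOn h.integral_norm_le U hδ'] with p hp
  have h2 : ∫⁻ x in V, ‖mollify Ω ρ (u p.1) x - mollify Ω ρ (u p.2) x‖ₑ ≤
      ENNReal.ofReal (δ / 3) := by
    calc _ ≤ ∫⁻ x in V, ENNReal.ofReal (δ / (3 * (v + 1))) := by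
          refine setLIntegral_mono' hV.measurableSet fun x hx ↦ ?_
          rw [← ofReal_norm]
          exact ENNReal.ofReal_le_ofReal (hp x (subset_closure hx))
      _ = ENNReal.ofReal (δ / (3 * (v + 1)) * v) := by
          rw [setLIntegral_const, ENNReal.ofReal_mul hδ'.le, hv_def, ENNReal.ofReal_toReal hVv]
      _ ≤ ENNReal.ofReal (δ / 3) := by
          refine ENNReal.ofReal_le_ofReal ?_
          rw [div_mul_eq_mul_div, div_le_div_iff₀ (by positivity) (by positivity)]
          nlinarith
  have hm1 : ∀ n, Measurable fun x ↦ ‖mollify Ω ρ (u n) x - u n x‖ₑ := fun n ↦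
    ((hρ.measurable_mollify (h.measurable n)).sub (h.measurable n)).enorm
  calc ∫⁻ x in V, ‖u p.1 x - u p.2 x‖ₑ
      ≤ ∫⁻ x in V, (‖mollify Ω ρ (u p.1) x - u p.1 x‖ₑ +
        (‖mollify Ω ρ (u p.2) x - u p.2 x‖ₑ +
          ‖mollify Ω ρ (u p.1) x - mollify Ω ρ (u p.2) x‖ₑ)) := by
        refine lintegral_mono fun x ↦ ?_
        have : u p.1 x - u p.2 x = (mollify Ω ρ (u p.2) x - u p.2 x +
            (mollify Ω ρ (u p.1) x - mollify Ω ρ (u p.2) x)) -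
            (mollify Ω ρ (u p.1) x - u p.1 x) := by ring
        rw [this]
        refine enorm_sub_le.trans ?_
        rw [add_comm]
        exact add_le_add le_rfl (enorm_add_le _ _)
    _ ≤ ENNReal.ofReal (δ / 3) + (ENNReal.ofReal (δ / 3) + ENNReal.ofReal (δ / 3)) := by
        rw [lintegral_add_left (hm1 _), lintegral_add_left (hm1 _)]
        exact add_le_add (h1 _) (add_le_add (h1 _) h2)
    _ = ENNReal.ofReal δ := by
        rw [← ENNReal.ofReal_add (by positivity) (by positivity),
          ← ENNReal.ofReal_add (by positivity) (by positivity)]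
        congr 1
        ring

/-- If arbitrarily small translates of `V` inside `Ω` have compactness, so has `V`. -/
theorem IsBoundedBVSeq.cauchyInL1On_of_translate (h : IsBoundedBVSeq Ω u μ C) (hΩ : IsOpen Ω)
    (hV : IsOpen V) (hVv : volume V ≠ ⊤)
    (hVΩ : ∀ δ : ℝ, 0 < δ → ∃ a : 𝔼 d, ‖a‖ ≤ δ ∧
      (∀ x ∈ V, ∀ s ∈ Icc (0 : ℝ) 1, x + s • a ∈ Ω) ∧
      CauchyInL1On U u ((fun x ↦ x - a) ⁻¹' V)) : CauchyInL1On U u V := by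
  intro δ hδ
  have hC0 := h.nonneg
  obtain ⟨a, ha, haΩ, hac⟩ := hVΩ (δ / (3 * (C + 1))) (by positivity)
  have h1 : ∀ n, ∫⁻ x in V, ‖u n (x + a) - u n x‖ₑ ≤ ENNReal.ofReal (δ / 3) := by
    intro n
    refine ((h.isDistribGradient n).lintegral_enorm_translate_sub_le hΩ hV hVv
      (h.integrableOn n) haΩ).trans ?_
    refine (mul_le_mul' le_rfl (h.variation_le n)).trans ?_
    rw [← ofReal_norm, ← ENNReal.ofReal_mul (norm_nonneg _)]
    refine ENNReal.ofReal_le_ofReal ?_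
    calc ‖a‖ * C ≤ δ / (3 * (C + 1)) * C := by gcongr
      _ ≤ δ / 3 := by
        rw [div_mul_eq_mul_div, div_le_div_iff₀ (by positivity) (by positivity)]
        nlinarith
  filter_upwards [hac (δ / 3) (by positivity)] with p hp
  have h2 : ∫⁻ x in V, ‖u p.1 (x + a) - u p.2 (x + a)‖ₑ ≤ ENNReal.ofReal (δ / 3) := by
    refine le_trans (le_of_eq ?_) hp
    have hm : Measurable fun x ↦ ‖u p.1 x - u p.2 x‖ₑ :=
      ((h.measurable _).sub (h.measurable _)).enorm
    rw [← (measurePreserving_add_right volume a).setLIntegral_comp_preimage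
      ((measurable_sub_const a) hV.measurableSet) hm]
    congr 2
    ext x
    simp
  have hm1 : ∀ n, Measurable fun x ↦ ‖u n (x + a) - u n x‖ₑ := fun n ↦
    (((h.measurable n).comp (measurable_add_const a)).sub (h.measurable n)).enorm
  calc ∫⁻ x in V, ‖u p.1 x - u p.2 x‖ₑ
      ≤ ∫⁻ x in V, (‖u p.1 (x + a) - u p.1 x‖ₑ + (‖u p.2 (x + a) - u p.2 x‖ₑ +
          ‖u p.1 (x + a) - u p.2 (x + a)‖ₑ)) := by
        refine lintegral_mono fun x ↦ ?_
        have : u p.1 x - u p.2 x = (u p.2 (x + a) - u p.2 x + (u p.1 (x + a) - u p.2 (x + a))) -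
            (u p.1 (x + a) - u p.1 x) := by ring
        rw [this]
        refine enorm_sub_le.trans ?_
        rw [add_comm]
        exact add_le_add le_rfl (enorm_add_le _ _)
    _ ≤ ENNReal.ofReal (δ / 3) + (ENNReal.ofReal (δ / 3) + ENNReal.ofReal (δ / 3)) := by
        rw [lintegral_add_left (hm1 _), lintegral_add_left (hm1 _)]
        exact add_le_add (h1 _) (add_le_add (h1 _) h2)
    _ = ENNReal.ofReal δ := by
        rw [← ENNReal.ofReal_add (by positivity) (by positivity),
          ← ENNReal.ofReal_add (by positivity) (by positivity)]
        congr 1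
        ring

/-- Near a boundary point of a Lipschitz domain, a piece of `Ω` can be pushed into the interior of
`Ω` by translations in the direction of the epigraph. -/
theorem HasLipschitzBoundary.exists_nhds_translate (hΩ : HasLipschitzBoundary Ω) {x : 𝔼 d}
    (hx : x ∈ frontier Ω) : ∃ r : ℝ, 0 < r ∧ ∃ e : 𝔼 d, ‖e‖ = 1 ∧ ∃ t₀ : ℝ, 0 < t₀ ∧
      ∀ t ∈ Ioo 0 t₀, (∀ y ∈ Ω ∩ Metric.ball x r, ∀ s ∈ Icc (0 : ℝ) 1, y + s • (t • e) ∈ Ω) ∧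
        ∃ ε : ℝ, 0 < ε ∧ ∀ y ∈ (fun y ↦ y - t • e) ⁻¹' (Ω ∩ Metric.ball x r),
          ∀ z, dist z y < ε → z ∈ Ω := by
  obtain ⟨r, hr, e, he, K, ψ, hψ, hΩψ⟩ := hΩ x hx
  have hmem : ∀ y ∈ Metric.ball x r, (y ∈ Ω ↔ ψ (y - inner ℝ y e • e) < inner ℝ y e) := by
    intro y hy
    have := Set.ext_iff.1 hΩψ y
    have hy' : dist y x < r := hy
    simpa [hy'] using this
  have hee : inner ℝ e e = (1 : ℝ) := by rw [real_inner_self_eq_norm_sq, he, one_pow]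
  refine ⟨r / 2, by positivity, e, he, r / 4, by positivity, fun t ht ↦ ⟨?_, ?_⟩⟩
  · rintro y ⟨hyΩ, hy⟩ s hs
    have hy' : y ∈ Metric.ball x r := Metric.ball_subset_ball (by linarith) hy
    have hst : 0 ≤ s * t := mul_nonneg hs.1 ht.1.le
    have hst' : s * t < r / 4 := (mul_le_of_le_one_left ht.1.le hs.2).trans_lt ht.2
    rw [smul_smul]
    have hz : y + (s * t) • e ∈ Metric.ball x r := by
      rw [Metric.mem_ball] at hy ⊢
      calc dist (y + (s * t) • e) x ≤ dist (y + (s * t) • e) y + dist y x := dist_triangle _ _ _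
        _ = s * t + dist y x := by
          rw [dist_eq_norm, add_sub_cancel_left, norm_smul, he, mul_one, Real.norm_of_nonneg hst]
        _ < r := by linarith
    rw [hmem _ hz, inner_add_left, real_inner_smul_left, hee, mul_one]
    have h1 : y + (s * t) • e - (inner ℝ y e + s * t) • e = y - inner ℝ y e • e := by
      rw [add_smul]
      abel
    rw [h1]
    linarith [(hmem y hy').1 hyΩ]
  · refine ⟨min (r / 4) (t / (1 + 2 * K)), lt_min (by positivity) (div_pos ht.1 (by positivity)), ?_⟩
    rintro y ⟨hyΩ, hy⟩ z hz
    simp only at hyΩ hy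
    set w := y - t • e with hw
    have hw' : w ∈ Metric.ball x r := Metric.ball_subset_ball (by linarith) hy
    have hz1 : dist z y < r / 4 := hz.trans_le (min_le_left _ _)
    have hz2 : dist z y * (1 + 2 * K) < t := by
      rw [← lt_div_iff₀ (by positivity)]
      exact hz.trans_le (min_le_right _ _)
    have hyw : y = w + t • e := by rw [hw]; abel
    have hdyw : dist y w = t := by
      rw [hyw, dist_eq_norm, add_sub_cancel_left, norm_smul, he, mul_one,
        Real.norm_of_nonneg ht.1.le]
    have hzb : z ∈ Metric.ball x r := by
      rw [Metric.mem_ball] at hy ⊢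
      calc dist z x ≤ dist z y + dist y w + dist w x := dist_triangle4 _ _ _ _
        _ < r := by rw [hdyw]; linarith [ht.2]
    rw [hmem z hzb]
    have h1 := (hmem w hw').1 hyΩ
    -- the projection onto the hyperplane orthogonal to `e` is `2`-Lipschitz and ignores `t • e`
    have hzw : inner ℝ z e = inner ℝ (z - y) e + t + inner ℝ w e := by
      have : z = (z - y) + t • e + w := by rw [hyw]; abel
      conv_lhs => rw [this]
      rw [inner_add_left, inner_add_left, real_inner_smul_left, hee, mul_one]
    have h2 : |inner ℝ (z - y) e| ≤ dist z y := by
      rw [dist_eq_norm]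
      simpa [he] using abs_real_inner_le_norm (z - y) e
    have h3 : dist (z - inner ℝ z e • e) (w - inner ℝ w e • e) ≤ 2 * dist z y := by
      have : z - inner ℝ z e • e - (w - inner ℝ w e • e) = (z - y) - inner ℝ (z - y) e • e := by
        rw [hzw, hyw]
        module
      rw [dist_eq_norm, this]
      calc _ ≤ ‖z - y‖ + ‖inner ℝ (z - y) e • e‖ := norm_sub_le _ _
        _ ≤ dist z y + dist z y := by
          rw [norm_smul, he, mul_one, ← dist_eq_norm]
          gcongr
          exact h2
        _ = _ := by ring
    have h4 := (hψ.dist_le_mul (z - inner ℝ z e • e) (w - inner ℝ w e • e)).trans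
      (mul_le_mul_of_nonneg_left h3 K.2)
    rw [Real.dist_eq] at h4
    have h5 := (abs_le.1 h4).2
    have h6 := (abs_le.1 h2).1
    linarith

/-- A bounded sequence in `BV` of a bounded Lipschitz domain is Cauchy in `L¹` along every
ultrafilter. -/
theorem IsBoundedBVSeq.cauchyInL1On (h : IsBoundedBVSeq Ω u μ C) (hΩ : IsOpen Ω)
    (hΩb : Bornology.IsBounded Ω) (hΩl : HasLipschitzBoundary Ω) : CauchyInL1On U u Ω := by
  have key : CauchyInL1On U u (Ω ∩ closure Ω) := by
    refine hΩb.isCompact_closure.induction_on (p := fun s ↦ CauchyInL1On U u (Ω ∩ s)) ?_ ?_ ?_ ?_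
    · intro δ hδ
      simp
    · exact fun s t hst ht ↦ ht.mono (inter_subset_inter_right _ hst)
    · intro s t hs ht
      rw [inter_union_distrib_left]
      exact hs.union ht
    · intro x hx
      by_cases hxΩ : x ∈ Ω
      · obtain ⟨r, hr, hrΩ⟩ := Metric.isOpen_iff.1 hΩ x hxΩ
        refine ⟨Metric.ball x (r / 2),
          mem_nhdsWithin_of_mem_nhds (Metric.ball_mem_nhds x (by positivity)), ?_⟩
        refine (h.cauchyInL1On_of_interior hΩ Metric.isOpen_ball Metric.isBounded_ball
          (ε₀ := r / 2) (by positivity) fun y hy z hz ↦ hrΩ ?_).mono inter_subset_right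
        rw [Metric.mem_ball] at hy ⊢
        linarith [dist_triangle z y x]
      · have hxf : x ∈ frontier Ω := by
          rw [hΩ.frontier_eq]
          exact ⟨hx, hxΩ⟩
        obtain ⟨r, hr, e, he, t₀, ht₀, ht⟩ := hΩl.exists_nhds_translate hxf
        refine ⟨Metric.ball x r, mem_nhdsWithin_of_mem_nhds (Metric.ball_mem_nhds x hr), ?_⟩
        have hV : IsOpen (Ω ∩ Metric.ball x r) := hΩ.inter Metric.isOpen_ball
        have hVb : Bornology.IsBounded (Ω ∩ Metric.ball x r) := hΩb.subset inter_subset_left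
        refine h.cauchyInL1On_of_translate hΩ hV hVb.measure_lt_top.ne fun δ hδ ↦ ?_
        have hmin : 0 < min δ t₀ := lt_min hδ ht₀
        have ht' : min δ t₀ / 2 ∈ Ioo 0 t₀ :=
          ⟨by positivity, (half_lt_self hmin).trans_le (min_le_right _ _)⟩
        obtain ⟨h1, ε, hε, h2⟩ := ht _ ht'
        refine ⟨(min δ t₀ / 2) • e, ?_, h1, ?_⟩
        · rw [norm_smul, he, mul_one, Real.norm_of_nonneg (by positivity)]
          linarith [min_le_left δ t₀]
        · refine h.cauchyInL1On_of_interior hΩ (hV.preimage (continuous_sub_right _)) ?_ hε h2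
          exact (AntilipschitzWith.of_le_mul_dist (K := 1) fun y z ↦ by
            simp).isBounded_preimage hVb
  rwa [inter_eq_left.2 subset_closure] at key

end Compactness

/-! ### Rellich compactness in `L¹` -/

section Rellich

variable {Ω : Set (𝔼 d)} {u : ℕ → 𝔼 d → ℝ} {μ : ℕ → VectorMeasure (𝔼 d) (𝔼 d)}

theorem IsDistribGradient.congr {u v : 𝔼 d → ℝ} {μ : VectorMeasure (𝔼 d) (𝔼 d)}
    (h : IsDistribGradient Ω u μ) (huv : u =ᵐ[volume.restrict Ω] v) : IsDistribGradient Ω v μ := by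
  refine ⟨h.finite, h.concentrated, fun φ h1 h2 h3 ↦ ?_⟩
  rw [← h.integral_eq φ h1 h2 h3]
  refine integral_congr_ae ?_
  filter_upwards [huv] with x hx
  rw [hx]

/-- Rellich's theorem: bounded sequences in `BV` of a bounded Lipschitz domain have subsequences
that converge in `L¹`. -/
theorem exists_subseq_tendsto_L1 (hΩ : IsOpen Ω) (hΩb : Bornology.IsBounded Ω)
    (hΩl : HasLipschitzBoundary Ω) (hu : ∀ n, IntegrableOn (u n) Ω)
    (hμ : ∀ n, IsDistribGradient Ω (u n) (μ n)) {C : ℝ} (hC : ∀ n, ∫ x in Ω, ‖u n x‖ ≤ C)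
    (hCμ : ∀ n, (μ n).variation Ω ≤ ENNReal.ofReal C) :
    ∃ v : 𝔼 d → ℝ, IntegrableOn v Ω ∧ ∃ φ : ℕ → ℕ, StrictMono φ ∧
      Tendsto (fun n ↦ ∫⁻ x in Ω, ‖u (φ n) x - v x‖ₑ) atTop (𝓝 0) := by
  -- measurable representatives, since translates of `u n` see the values outside `Ω`
  let w : ℕ → 𝔼 d → ℝ := fun n ↦ (hu n).1.mk (u n)
  have hw : ∀ n, u n =ᵐ[volume.restrict Ω] w n := fun n ↦ (hu n).1.ae_eq_mk
  have hwB : IsBoundedBVSeq Ω w μ C :=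
    { measurable := fun n ↦ (hu n).1.measurable_mk
      integrableOn := fun n ↦ (hu n).congr (hw n)
      isDistribGradient := fun n ↦ (hμ n).congr (hw n)
      integral_norm_le := fun n ↦ by
        refine le_of_eq_of_le (integral_congr_ae ?_) (hC n)
        filter_upwards [hw n] with x hx
        rw [hx]
      variation_le := hCμ }
  let U : Ultrafilter ℕ := hyperfilter ℕ
  let f : ℕ → Lp ℝ 1 (volume.restrict Ω) := fun n ↦ (hu n).toL1 (u n)
  have hfe : ∀ n m, edist (f n) (f m) = ∫⁻ x in Ω, ‖w n x - w m x‖ₑ := by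
    intro n m
    refine (Integrable.edist_toL1_toL1 _ _ (hu n) (hu m)).trans ?_
    refine lintegral_congr_ae ?_
    filter_upwards [hw n, hw m] with x hx hx'
    rw [hx, hx', edist_eq_enorm_sub]
  have hcauchy : Cauchy (map f (U : Filter ℕ)) := by
    rw [uniformity_basis_edist_le.cauchy_iff]
    refine ⟨inferInstance, fun ε hε ↦ ?_⟩
    obtain ⟨δ, hδ0, hδ⟩ : ∃ δ : ℝ, 0 < δ ∧ ENNReal.ofReal δ ≤ ε := by
      obtain ⟨δ, hδ0, hδ⟩ := ENNReal.lt_iff_exists_nnreal_btwn.1 hε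
      exact ⟨δ, by simpa using hδ0, by simpa using hδ.le⟩
    have h1 := hwB.cauchyInL1On (U := U) hΩ hΩb hΩl δ hδ0
    obtain ⟨A, hA, hAp⟩ := (eventually_prod_self_iff (r := fun n m ↦
      ∫⁻ x in Ω, ‖w n x - w m x‖ₑ ≤ ENNReal.ofReal δ)).1 h1
    refine ⟨f '' A, image_mem_map hA, ?_⟩
    rintro _ ⟨n, hn, rfl⟩ _ ⟨m, hm, rfl⟩
    change edist (f n) (f m) ≤ ε
    rw [hfe]
    exact (hAp n hn m hm).trans hδ
  obtain ⟨ℓ, hℓ⟩ := CompleteSpace.complete hcauchy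
  have hclus : MapClusterPt ℓ atTop f :=
    (Filter.Tendsto.mapClusterPt (F := (U : Filter ℕ)) (u := f) hℓ).mono
      Nat.hyperfilter_le_atTop
  obtain ⟨φ, hφ, hlim⟩ := hclus.tendsto_subseq
  refine ⟨ℓ, L1.integrable_coeFn ℓ, φ, hφ, ?_⟩
  have h2 := tendsto_iff_edist_tendsto_0.1 hlim
  refine h2.congr fun n ↦ ?_
  rw [Function.comp_apply, L1.edist_def]
  refine lintegral_congr_ae ?_
  filter_upwards [(hu (φ n)).coeFn_toL1] with x hx
  rw [edist_eq_enorm_sub]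
  simp only [f]
  rw [hx]

end Rellich

/-! ### Closedness of `BV` under `L¹` convergence -/

section Representation

/-- A linear functional dominated by a Hilbert seminorm is represented by a vector. -/
theorem exists_inner_eq_of_abs_le {V H : Type*} [AddCommGroup V] [Module ℝ V]
    [NormedAddCommGroup H] [InnerProductSpace ℝ H] [CompleteSpace H] (J : V →ₗ[ℝ] H)
    (ℓ : V →ₗ[ℝ] ℝ) {M : ℝ} (h : ∀ v, |ℓ v| ≤ M * ‖J v‖) : ∃ z : H, ∀ v, ℓ v = inner ℝ z (J v) := by
  have hker : LinearMap.ker J ≤ LinearMap.ker ℓ := by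
    intro v hv
    rw [LinearMap.mem_ker] at hv ⊢
    have := h v
    rw [hv, norm_zero, mul_zero] at this
    exact abs_nonpos_iff.1 this
  let f₀ : LinearMap.range J →ₗ[ℝ] ℝ :=
    ((LinearMap.ker J).liftQ ℓ hker).comp J.quotKerEquivRange.symm.toLinearMap
  have hf₀ : ∀ v, f₀ ⟨J v, LinearMap.mem_range_self J v⟩ = ℓ v := by
    intro v
    have : J.quotKerEquivRange.symm ⟨J v, LinearMap.mem_range_self J v⟩ =
        (LinearMap.ker J).mkQ v := J.quotKerEquivRange_symm_apply_image v _
    simp [f₀, this]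
  let f : LinearMap.range J →L[ℝ] ℝ := f₀.mkContinuous M (by
    rintro ⟨_, v, rfl⟩
    rw [hf₀]
    exact h v)
  obtain ⟨g, hg, -⟩ := exists_extension_norm_eq _ f
  refine ⟨(InnerProductSpace.toDual ℝ H).symm g, fun v ↦ ?_⟩
  rw [InnerProductSpace.toDual_symm_apply, ← hf₀ v]
  exact (hg ⟨J v, LinearMap.mem_range_self J v⟩).symm

end Representation

section Closure

variable {Ω : Set (𝔼 d)} {u : ℕ → 𝔼 d → ℝ} {v : 𝔼 d → ℝ} {μ : ℕ → VectorMeasure (𝔼 d) (𝔼 d)}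

theorem IsTest.integrableOn_smul_gradient {φ : 𝔼 d → ℝ} (hφ : IsTest Ω φ) (hv : IntegrableOn v Ω) :
    IntegrableOn (fun x ↦ v x • gradient φ x) Ω := by
  obtain ⟨C, hC⟩ := hφ.exists_gradient_bound
  exact hv.smul_bdd C hφ.continuous_gradient.aestronglyMeasurable (ae_of_all _ hC)

theorem tendsto_integral_smul_gradient (hu : ∀ n, IntegrableOn (u n) Ω) (hv : IntegrableOn v Ω)
    (hlim : Tendsto (fun n ↦ ∫⁻ x in Ω, ‖u n x - v x‖ₑ) atTop (𝓝 0)) {φ : 𝔼 d → ℝ}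
    (hφ : IsTest Ω φ) :
    Tendsto (fun n ↦ ∫ x in Ω, u n x • gradient φ x) atTop (𝓝 (∫ x in Ω, v x • gradient φ x)) := by
  obtain ⟨C, hC⟩ := hφ.exists_gradient_bound
  have hg : AEStronglyMeasurable (gradient φ) (volume.restrict Ω) :=
    hφ.continuous_gradient.aestronglyMeasurable
  refine tendsto_integral_of_L1 _ (hv.1.smul hg)
    (Eventually.of_forall fun n ↦ hφ.integrableOn_smul_gradient (hu n)) ?_
  refine tendsto_of_tendsto_of_tendsto_of_le_of_le (g := fun _ ↦ 0)
    (h := fun n ↦ ENNReal.ofReal C * ∫⁻ x in Ω, ‖u n x - v x‖ₑ) tendsto_const_nhds ?_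
    (fun _ ↦ zero_le) fun n ↦ ?_
  · simpa using ENNReal.Tendsto.const_mul hlim (Or.inr (by simp : ENNReal.ofReal C ≠ ⊤))
  · change ∫⁻ x in Ω, ‖u n x • gradient φ x - v x • gradient φ x‖ₑ ≤
      ENNReal.ofReal C * ∫⁻ x in Ω, ‖u n x - v x‖ₑ
    rw [← lintegral_const_mul' _ _ (by simp)]
    refine lintegral_mono fun x ↦ ?_
    rw [← sub_smul, enorm_smul, mul_comm]
    gcongr
    rw [← ofReal_norm]
    exact ENNReal.ofReal_le_ofReal (hC x)

/-- Gradients of `L¹`-convergent sequences converge as distributions. -/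
theorem testTendsto_of_tendsto_L1 {ν : VectorMeasure (𝔼 d) (𝔼 d)} (hu : ∀ n, IntegrableOn (u n) Ω)
    (hv : IntegrableOn v Ω) (hlim : Tendsto (fun n ↦ ∫⁻ x in Ω, ‖u n x - v x‖ₑ) atTop (𝓝 0))
    (hμ : ∀ n, IsDistribGradient Ω (u n) (μ n)) (hν : IsDistribGradient Ω v ν) :
    TestTendsto Ω atTop μ ν := by
  intro φ hφ
  have h := (tendsto_integral_smul_gradient hu hv hlim hφ).neg
  rw [hν.integral_eq φ hφ.1 hφ.2 hφ.3, neg_neg] at h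
  refine h.congr fun n ↦ ?_
  rw [(hμ n).integral_eq φ hφ.1 hφ.2 hφ.3, neg_neg]

/-- The space of test functions in `Ω`. -/
def testSubmodule (Ω : Set (𝔼 d)) : Submodule ℝ (𝔼 d → ℝ) where
  carrier := {φ | IsTest Ω φ}
  add_mem' {φ ψ} hφ hψ := ⟨hφ.1.add hψ.1, hφ.2.add hψ.2, by
    refine (closure_mono (Function.support_add φ ψ)).trans ?_
    rw [closure_union]
    exact union_subset hφ.3 hψ.3⟩
  zero_mem' := ⟨contDiff_const, HasCompactSupport.zero, by simp [tsupport]⟩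
  smul_mem' c φ hφ := ⟨contDiff_const.smul hφ.1, hφ.2.smul_left (f := fun _ ↦ c),
    (tsupport_smul_subset_right (fun _ ↦ c) φ).trans hφ.3⟩

/-- A function whose gradient is dominated, as a distribution, by a finite measure is of bounded
variation. The measure `Dv` is constructed by representing the components of the distribution
in `L²` of the dominating measure. -/
theorem isBV_of_norm_integral_le (hΩ : MeasurableSet Ω) (hv : IntegrableOn v Ω) (ν : Measure (𝔼 d))
    [IsFiniteMeasure ν]
    (h : ∀ φ : 𝔼 d → ℝ, IsTest Ω φ → ‖∫ x in Ω, v x • gradient φ x‖ ≤ ∫ x, ‖φ x‖ ∂ν) :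
    IsBV Ω v := by
  let ν' := ν.restrict Ω
  have hL2 : ∀ φ : testSubmodule Ω, MemLp (φ : 𝔼 d → ℝ) 2 ν' := fun φ ↦
    φ.2.contDiff.continuous.memLp_of_hasCompactSupport φ.2.hasCompactSupport
  let J : testSubmodule Ω →ₗ[ℝ] Lp ℝ 2 ν' :=
    { toFun := fun φ ↦ (hL2 φ).toLp _
      map_add' := fun φ ψ ↦ MemLp.toLp_add (hL2 φ) (hL2 ψ)
      map_smul' := fun c φ ↦ MemLp.toLp_const_smul c (hL2 φ) }
  have hint : ∀ φ : testSubmodule Ω,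
      Integrable (fun x ↦ v x • gradient (φ : 𝔼 d → ℝ) x) (volume.restrict Ω) := fun φ ↦
    IsTest.integrableOn_smul_gradient φ.2 hv
  have hd : ∀ (φ : testSubmodule Ω) x, DifferentiableAt ℝ (φ : 𝔼 d → ℝ) x := fun φ x ↦
    (φ.2.contDiff.differentiable (by simp)) x
  let T : testSubmodule Ω →ₗ[ℝ] 𝔼 d :=
    { toFun := fun φ ↦ ∫ x in Ω, v x • gradient (φ : 𝔼 d → ℝ) x
      map_add' := fun φ ψ ↦ by
        rw [← integral_add (hint φ) (hint ψ)]
        refine integral_congr_ae (ae_of_all _ fun x ↦ ?_)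
        simp only [gradient, Submodule.coe_add]
        rw [fderiv_add (hd φ x) (hd ψ x), map_add, smul_add]
      map_smul' := fun c φ ↦ by
        rw [RingHom.id_apply, ← integral_smul]
        refine integral_congr_ae (ae_of_all _ fun x ↦ ?_)
        simp only [gradient, Submodule.coe_smul]
        rw [fderiv_const_smul (hd φ x), map_smul, smul_comm] }
  have hT : ∀ φ, ‖T φ‖ ≤ (ν' univ ^ (1 / 2 : ℝ)).toReal * ‖J φ‖ := by
    intro φ
    refine (h φ φ.2).trans ?_
    have hfin : ν' univ ^ (1 / 2 : ℝ) ≠ ⊤ :=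
      ENNReal.rpow_ne_top_of_nonneg (by norm_num) (measure_ne_top _ _)
    have h1 : ∫ x, ‖(φ : 𝔼 d → ℝ) x‖ ∂ν = ∫ x, ‖(φ : 𝔼 d → ℝ) x‖ ∂ν' := by
      refine (setIntegral_eq_integral_of_forall_compl_eq_zero fun x hx ↦ ?_).symm
      rw [IsTest.eq_zero φ.2 hx, norm_zero]
    have h2 := eLpNorm_le_eLpNorm_mul_rpow_measure_univ (p := 1) (q := 2) (μ := ν')
      (by norm_num) (hL2 φ).1
    rw [h1, integral_norm_eq_lintegral_enorm (hL2 φ).1, ← eLpNorm_one_eq_lintegral_enorm, mul_comm]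
    change _ ≤ ‖(hL2 φ).toLp _‖ * _
    rw [Lp.norm_toLp, ← ENNReal.toReal_mul]
    refine ENNReal.toReal_mono (ENNReal.mul_ne_top (hL2 φ).2.ne hfin) (h2.trans_eq ?_)
    norm_num
  have hz : ∀ i : Fin d, ∃ z : Lp ℝ 2 ν', ∀ φ, T φ i = inner ℝ z (J φ) := fun i ↦
    exists_inner_eq_of_abs_le J ((EuclideanSpace.proj i : 𝔼 d →L[ℝ] ℝ).toLinearMap.comp T)
      fun φ ↦ (PiLp.norm_apply_le (T φ) i).trans (hT φ)
  choose z hz using hz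
  let g : 𝔼 d → 𝔼 d := fun x ↦ WithLp.toLp 2 fun i ↦ -z i x
  have hg : Integrable g ν' := Integrable.of_eval_piLp fun i ↦
    ((Lp.memLp (z i)).integrable (by norm_num)).neg
  have hvar : (ν'.withDensityᵥ g).variation = ν'.withDensity fun x ↦ ‖g x‖ₑ :=
    Measure.variation_withDensityᵥ hg
  have hfin : (ν'.withDensityᵥ g).variation univ ≠ ⊤ := by
    rw [hvar, withDensity_apply _ MeasurableSet.univ, Measure.restrict_univ]
    exact hg.2.ne
  refine ⟨hv, ν'.withDensityᵥ g, hfin, ?_, fun φ h1 h2 h3 ↦ ?_⟩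
  · rw [hvar]
    refine withDensity_absolutelyContinuous _ _ ?_
    rw [Measure.restrict_apply hΩ.compl, compl_inter_self, measure_empty]
  · have hφ : IsTest Ω φ := ⟨h1, h2, h3⟩
    have : IsFiniteMeasure (ν'.withDensityᵥ g).variation := ⟨hfin.lt_top⟩
    rw [integral_withDensityᵥ hg (hφ.integrable _)]
    ext i
    have h4 := hz i ⟨φ, hφ⟩
    change (∫ x in Ω, v x • gradient φ x) i = _ at h4
    rw [h4, L2.inner_def]
    simp only [ContinuousLinearMap.lsmul_apply, PiLp.neg_apply]
    have h5 : (∫ x, φ x • g x ∂ν') i = ∫ x, (φ x • g x) i ∂ν' := by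
      obtain ⟨C, hC⟩ := hφ.hasCompactSupport.exists_bound_of_continuous hφ.contDiff.continuous
      exact ((EuclideanSpace.proj i : 𝔼 d →L[ℝ] ℝ).integral_comp_comm
        (hg.bdd_smul C hφ.contDiff.continuous.aestronglyMeasurable (ae_of_all _ hC))).symm
    rw [h5, ← integral_neg]
    refine integral_congr_ae ?_
    filter_upwards [(hL2 ⟨φ, hφ⟩).coeFn_toLp] with x hx
    change inner ℝ (z i x) ((hL2 ⟨φ, hφ⟩).toLp _ x) = _
    rw [hx]
    simp [g]

/-- `L¹`-limits of functions with bounded total variations are of bounded variation. -/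
theorem isBV_of_tendsto_L1 (hΩ : IsOpen Ω) (hΩb : Bornology.IsBounded Ω)
    (hu : ∀ n, IntegrableOn (u n) Ω) (hv : IntegrableOn v Ω)
    (hlim : Tendsto (fun n ↦ ∫⁻ x in Ω, ‖u n x - v x‖ₑ) atTop (𝓝 0))
    (hμ : ∀ n, IsDistribGradient Ω (u n) (μ n)) {C : ℝ≥0}
    (hC : ∀ n, (μ n).variation Ω ≤ C) : IsBV Ω v := by
  let ρ : ℕ → FiniteMeasure (𝔼 d) := fun n ↦ ⟨(μ n).variation, ⟨(hμ n).finite.lt_top⟩⟩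
  have hK : IsCompact (closure Ω) := hΩb.isCompact_closure
  have hmem : ∀ n, ρ n ∈ {μ : FiniteMeasure (𝔼 d) | μ.mass ≤ C ∧ μ (closure Ω)ᶜ = 0} := by
    intro n
    constructor
    · rw [← ENNReal.coe_le_coe, FiniteMeasure.ennreal_mass]
      exact ((hμ n).variation_eq hΩ.measurableSet).trans_le (hC n)
    · rw [FiniteMeasure.null_iff_toMeasure_null]
      exact measure_mono_null (compl_subset_compl.2 subset_closure) (hμ n).concentrated
  obtain ⟨ν, -, hν⟩ := (isCompact_setOfPred_finiteMeasure_le_of_isCompact C hK).ultrafilter_le_nhds'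
    ((hyperfilter ℕ).map ρ) (Ultrafilter.mem_map.2 (univ_mem' hmem))
  have hν' : Tendsto ρ (hyperfilter ℕ) (𝓝 ν) := hν
  refine isBV_of_norm_integral_le hΩ.measurableSet hv (ν : Measure (𝔼 d)) fun φ hφ ↦ ?_
  have h1 := (tendsto_integral_smul_gradient hu hv hlim hφ).norm.mono_left
    Nat.hyperfilter_le_atTop
  obtain ⟨B, hB⟩ := hφ.hasCompactSupport.exists_bound_of_continuous hφ.contDiff.continuous
  have h2 := FiniteMeasure.tendsto_iff_forall_integral_tendsto.1 hν'
    (BoundedContinuousFunction.ofNormedAddCommGroup (fun x ↦ ‖φ x‖) hφ.contDiff.continuous.norm B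
      (fun x ↦ by simpa using hB x))
  refine le_of_tendsto_of_tendsto' h1 h2 fun n ↦ ?_
  rw [(hμ n).integral_eq φ hφ.1 hφ.2 hφ.3, norm_neg]
  refine VectorMeasure.norm_integral_le_integral_norm.trans ?_
  refine (mul_le_mul_of_nonneg_right norm_lsmul_le_one (by positivity)).trans_eq (one_mul _)

end Closure

section BV

variable {Ω : Set (𝔼 d)} {u v : 𝔼 d → ℝ}

theorem IsBV.isDistribGradient (h : IsBV Ω u) : IsDistribGradient Ω u (distribGradient Ω u) := by
  rw [distribGradient, dif_pos h.2]
  exact h.2.choose_spec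

theorem IsDistribGradient.sub {μ ν : VectorMeasure (𝔼 d) (𝔼 d)} (hu : IntegrableOn u Ω)
    (hv : IntegrableOn v Ω) (hμ : IsDistribGradient Ω u μ) (hν : IsDistribGradient Ω v ν) :
    IsDistribGradient Ω (fun x ↦ u x - v x) (μ - ν) where
  finite := ne_top_of_le_ne_top (ENNReal.add_ne_top.2 ⟨hμ.finite, hν.finite⟩)
    (VectorMeasure.variation_sub_le _)
  concentrated := by
    refine le_antisymm ((VectorMeasure.variation_sub_le _).trans_eq ?_) zero_le
    rw [Measure.add_apply, hμ.concentrated, hν.concentrated, add_zero]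
  integral_eq φ h1 h2 h3 := by
    have hφ : IsTest Ω φ := ⟨h1, h2, h3⟩
    have : IsFiniteMeasure μ.variation := ⟨hμ.finite.lt_top⟩
    have : IsFiniteMeasure ν.variation := ⟨hν.finite.lt_top⟩
    rw [VectorMeasure.integral_sub_vectorMeasure (hφ.integrable _) (hφ.integrable _), neg_sub']
    simp_rw [sub_smul]
    rw [integral_sub (hφ.integrableOn_smul_gradient hu) (hφ.integrableOn_smul_gradient hv), hμ.integral_eq φ h1 h2 h3, hν.integral_eq φ h1 h2 h3]

theorem IsBV.sub (hu : IsBV Ω u) (hv : IsBV Ω v) : IsBV Ω fun x ↦ u x - v x :=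
  ⟨hu.1.sub hv.1, _, hu.isDistribGradient.sub hu.1 hv.1 hv.isDistribGradient⟩

theorem isBV_zero : IsBV Ω fun _ ↦ 0 :=
  ⟨integrableOn_zero, 0, by simp, by simp, fun φ _ _ _ ↦ by simp⟩

/-- Lower semicontinuity of the total variation in `L¹`. -/
theorem eventually_lt_totalVariation {u : ℕ → 𝔼 d → ℝ} (hΩ : IsOpen Ω) (hu : ∀ n, IsBV Ω (u n))
    (hv : IsBV Ω v) (hlim : Tendsto (fun n ↦ ∫⁻ x in Ω, ‖u n x - v x‖ₑ) atTop (𝓝 0)) {a : ℝ≥0∞}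
    (ha : a < totalVariation Ω v) : ∀ᶠ n in atTop, a < totalVariation Ω (u n) :=
  (testTendsto_of_tendsto_L1 (fun n ↦ (hu n).1) hv.1 hlim (fun n ↦ (hu n).isDistribGradient)
    hv.isDistribGradient).eventually_lt_variation hΩ (fun n ↦ (hu n).isDistribGradient.finite)
    hv.isDistribGradient.finite hv.isDistribGradient.concentrated ha

end BV

/-! ### The fidelity and the lower level problem -/

section Fidelity

variable {Ω : Set (𝔼 d)} {u w f : 𝔼 d → ℝ} {a b a' b' : ℝ}

theorem fidelity_le {v : 𝔼 d → ℝ} (hv : IntegrableOn v Ω) :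
    fidelity Ω a b u f ≤ ENNReal.ofReal a * eLpNorm v 1 (volume.restrict Ω) +
      ENNReal.ofReal (b / 2) * eLpNorm (fun x => f x - u x - v x) 2 (volume.restrict Ω) ^ 2 :=
  iInf₂_le v hv

/-- The fidelity is Lipschitz in `L¹`: the difference `w - u` can be absorbed into `v`. -/
theorem fidelity_le_add (hu : IntegrableOn u Ω) (hw : IntegrableOn w Ω) :
    fidelity Ω a b u f ≤
      fidelity Ω a b w f + ENNReal.ofReal a * ∫⁻ x in Ω, ‖w x - u x‖ₑ := by
  refine ENNReal.le_of_forall_pos_le_add fun ε hε hfin ↦ ?_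
  have hne : fidelity Ω a b w f ≠ ⊤ := (lt_of_le_of_lt le_self_add hfin).ne
  have h1 : fidelity Ω a b w f < fidelity Ω a b w f + ε :=
    ENNReal.lt_add_right hne (by simpa using hε.ne')
  obtain ⟨v, hv⟩ := iInf_lt_iff.1 h1
  obtain ⟨hvi, hv⟩ := iInf_lt_iff.1 hv
  refine (fidelity_le (hvi.add (hw.sub hu))).trans ?_
  have h2 : eLpNorm (v + (w - u)) 1 (volume.restrict Ω) ≤
      eLpNorm v 1 (volume.restrict Ω) + ∫⁻ x in Ω, ‖w x - u x‖ₑ := by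
    refine (eLpNorm_add_le hvi.1 (hw.sub hu).1 le_rfl).trans_eq ?_
    rw [eLpNorm_one_eq_lintegral_enorm (f := w - u)]
    rfl
  have h3 : (fun x ↦ f x - u x - (v + (w - u)) x) = fun x ↦ f x - w x - v x := by
    ext x
    simp only [Pi.add_apply, Pi.sub_apply]
    ring
  rw [h3]
  refine (add_le_add_left (mul_le_mul_right h2 _) _).trans ?_
  rw [mul_add, add_right_comm, add_right_comm _ _ (ε : ℝ≥0∞)]
  exact add_le_add_left hv.le _

theorem ofReal_mul_fidelity_le {r : ℝ} (hr : 0 ≤ r) (ha : r * a ≤ a') (hb : r * b ≤ b') :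
    ENNReal.ofReal r * fidelity Ω a b u f ≤ fidelity Ω a' b' u f := by
  refine le_iInf₂ fun v hv ↦ (mul_le_mul_right (fidelity_le hv) _).trans ?_
  rw [mul_add, ← mul_assoc, ← mul_assoc, ← ENNReal.ofReal_mul hr, ← ENNReal.ofReal_mul hr]
  gcongr
  linarith

theorem fidelity_le_ofReal_mul {t : ℝ} (ht : 0 < t) (ha : a' ≤ t * a) (hb : b' ≤ t * b) :
    fidelity Ω a' b' u f ≤ ENNReal.ofReal t * fidelity Ω a b u f := by
  have h := ofReal_mul_fidelity_le (Ω := Ω) (u := u) (f := f) (a := a') (b := b') (a' := a)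
    (b' := b) (inv_nonneg.2 ht.le) ((inv_mul_le_iff₀ ht).2 ha) ((inv_mul_le_iff₀ ht).2 hb)
  calc fidelity Ω a' b' u f
      = ENNReal.ofReal t * (ENNReal.ofReal t⁻¹ * fidelity Ω a' b' u f) := by
        rw [← mul_assoc, ← ENNReal.ofReal_mul ht.le, mul_inv_cancel₀ ht.ne', ENNReal.ofReal_one,
          one_mul]
    _ ≤ _ := by gcongr

/-- Continuity of the fidelity in the parameters, away from the coordinate axes. -/
theorem tendsto_fidelity {p : ℕ → ℝ × ℝ} {q : ℝ × ℝ} (hp : Tendsto p atTop (𝓝 q)) (h1 : 0 < q.1)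
    (h2 : 0 < q.2) :
    Tendsto (fun n ↦ fidelity Ω (p n).1 (p n).2 u f) atTop (𝓝 (fidelity Ω q.1 q.2 u f)) := by
  have hp1 : Tendsto (fun n ↦ (p n).1 / q.1) atTop (𝓝 1) := by
    simpa [h1.ne'] using ((continuous_fst.tendsto q).comp hp).div_const q.1
  have hp2 : Tendsto (fun n ↦ (p n).2 / q.2) atTop (𝓝 1) := by
    simpa [h2.ne'] using ((continuous_snd.tendsto q).comp hp).div_const q.2
  have hmin : Tendsto (fun n ↦ min ((p n).1 / q.1) ((p n).2 / q.2)) atTop (𝓝 1) := by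
    simpa using hp1.min hp2
  have hmax : Tendsto (fun n ↦ max ((p n).1 / q.1) ((p n).2 / q.2)) atTop (𝓝 1) := by
    simpa using hp1.max hp2
  have hlim : ∀ g : ℕ → ℝ, Tendsto g atTop (𝓝 1) →
      Tendsto (fun n ↦ ENNReal.ofReal (g n) * fidelity Ω q.1 q.2 u f) atTop
        (𝓝 (fidelity Ω q.1 q.2 u f)) := by
    intro g hg
    simpa using ENNReal.Tendsto.mul_const (b := fidelity Ω q.1 q.2 u f)
      (ENNReal.tendsto_ofReal hg) (Or.inl (by simp))
  refine tendsto_of_tendsto_of_tendsto_of_le_of_le' (hlim _ hmin) (hlim _ hmax) ?_ ?_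
  · filter_upwards [hmin.eventually_const_lt zero_lt_one] with n hn
    refine ofReal_mul_fidelity_le hn.le ?_ ?_
    · exact (mul_le_mul_of_nonneg_right (min_le_left _ _) h1.le).trans_eq
        (div_mul_cancel₀ _ h1.ne')
    · exact (mul_le_mul_of_nonneg_right (min_le_right _ _) h2.le).trans_eq
        (div_mul_cancel₀ _ h2.ne')
  · filter_upwards [hmax.eventually_const_lt zero_lt_one] with n hn
    refine fidelity_le_ofReal_mul hn ?_ ?_
    · exact (div_mul_cancel₀ _ h1.ne').symm.trans_le
        (mul_le_mul_of_nonneg_right (le_max_left _ _) h1.le)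
    · exact (div_mul_cancel₀ _ h2.ne').symm.trans_le
        (mul_le_mul_of_nonneg_right (le_max_right _ _) h2.le)

theorem fidelity_zero_left (hu : IntegrableOn u Ω) (hf : IntegrableOn f Ω) :
    fidelity Ω 0 b u f = 0 := by
  refine le_antisymm ((fidelity_le (hf.sub hu)).trans_eq ?_) zero_le
  simp

theorem fidelity_zero_right : fidelity Ω a 0 u f = 0 := by
  refine le_antisymm ((fidelity_le integrableOn_zero).trans_eq ?_) zero_le
  simp

theorem fidelity_zero_le_left (hf : IntegrableOn f Ω) :
    fidelity Ω a b (fun _ ↦ 0) f ≤ ENNReal.ofReal a * eLpNorm f 1 (volume.restrict Ω) :=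
  (fidelity_le hf).trans_eq (by simp)

theorem fidelity_zero_le_right :
    fidelity Ω a b (fun _ ↦ 0) f ≤
      ENNReal.ofReal (b / 2) * eLpNorm f 2 (volume.restrict Ω) ^ 2 :=
  (fidelity_le integrableOn_zero).trans_eq (by simp)

/-- The bound of the `L¹` norm by the `L²` norm, made linear in the square of the latter by
`t ≤ 1 + t²`. -/
theorem eLpNorm_one_le_of_sq {g : 𝔼 d → ℝ}
    (hg : AEStronglyMeasurable g (volume.restrict Ω)) :
    eLpNorm g 1 (volume.restrict Ω) ≤
      (1 + eLpNorm g 2 (volume.restrict Ω) ^ 2) * volume Ω ^ (1 / 2 : ℝ) := by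
  have h := eLpNorm_le_eLpNorm_mul_rpow_measure_univ (p := 1) (q := 2) (by norm_num) hg
  rw [Measure.restrict_apply_univ] at h
  refine h.trans ?_
  have h1 : (1 / (1 : ℝ≥0∞).toReal - 1 / (2 : ℝ≥0∞).toReal) = 1 / 2 := by norm_num
  rw [h1]
  gcongr
  rcases le_total (eLpNorm g 2 (volume.restrict Ω)) 1 with h2 | h2
  · exact h2.trans le_self_add
  · exact (le_self_pow h2 two_ne_zero).trans le_add_self

/-- Coercivity of the fidelity in `L¹`, uniformly for parameters bounded away from zero. -/
theorem exists_eLpNorm_one_le (hΩ : volume Ω ≠ ⊤) (hf : IntegrableOn f Ω) {C : ℝ≥0∞} (hC : C ≠ ⊤)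
    (ha : 0 < a) (hb : 0 < b) :
    ∃ K : ℝ≥0∞, K ≠ ⊤ ∧ ∀ (u : 𝔼 d → ℝ) (a' b' : ℝ), IntegrableOn u Ω → a ≤ a' → b ≤ b' →
      fidelity Ω a' b' u f ≤ C → eLpNorm u 1 (volume.restrict Ω) ≤ K := by
  have ha0 : ENNReal.ofReal a ≠ 0 := by simpa using ha
  have hb0 : ENNReal.ofReal (b / 2) ≠ 0 := by simpa using hb
  refine ⟨eLpNorm f 1 (volume.restrict Ω) + (C + 1) / ENNReal.ofReal a +
    (1 + (C + 1) / ENNReal.ofReal (b / 2)) * volume Ω ^ (1 / 2 : ℝ), ?_,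
    fun u a' b' hu haa hbb h ↦ ?_⟩
  · have h1 : eLpNorm f 1 (volume.restrict Ω) ≠ ⊤ := (memLp_one_iff_integrable.2 hf).2.ne
    have h2 : (C + 1) / ENNReal.ofReal a ≠ ⊤ := ENNReal.div_ne_top (by simp [hC]) ha0
    have h3 : (C + 1) / ENNReal.ofReal (b / 2) ≠ ⊤ := ENNReal.div_ne_top (by simp [hC]) hb0
    have h4 : volume Ω ^ (1 / 2 : ℝ) ≠ ⊤ := ENNReal.rpow_ne_top_of_nonneg (by norm_num) hΩ
    finiteness
  · have h1 : fidelity Ω a' b' u f < C + 1 :=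
      h.trans_lt (ENNReal.lt_add_right hC one_ne_zero)
    obtain ⟨v, hv⟩ := iInf_lt_iff.1 h1
    obtain ⟨hvi, hv⟩ := iInf_lt_iff.1 hv
    have hg : AEStronglyMeasurable (fun x ↦ f x - u x - v x) (volume.restrict Ω) :=
      ((hf.sub hu).sub hvi).1
    have h2 : eLpNorm v 1 (volume.restrict Ω) ≤ (C + 1) / ENNReal.ofReal a := by
      rw [ENNReal.le_div_iff_mul_le (Or.inl ha0) (Or.inl ENNReal.ofReal_ne_top), mul_comm]
      refine le_trans ?_ (le_self_add.trans hv.le)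
      gcongr
    have h3 : eLpNorm (fun x ↦ f x - u x - v x) 2 (volume.restrict Ω) ^ 2 ≤
        (C + 1) / ENNReal.ofReal (b / 2) := by
      rw [ENNReal.le_div_iff_mul_le (Or.inl hb0) (Or.inl ENNReal.ofReal_ne_top), mul_comm]
      refine le_trans ?_ (le_add_self.trans hv.le)
      gcongr
    have h4 : u = f - v - fun x ↦ f x - u x - v x := by
      ext x
      simp only [Pi.sub_apply]
      ring
    calc eLpNorm u 1 (volume.restrict Ω)
        = eLpNorm (f - v - fun x ↦ f x - u x - v x) 1 (volume.restrict Ω) := by rw [← h4]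
      _ ≤ eLpNorm f 1 (volume.restrict Ω) + eLpNorm v 1 (volume.restrict Ω) +
          eLpNorm (fun x ↦ f x - u x - v x) 1 (volume.restrict Ω) :=
        (eLpNorm_sub_le (hf.sub hvi).1 hg le_rfl).trans
          (add_le_add_left (eLpNorm_sub_le hf.1 hvi.1 le_rfl) _)
      _ ≤ _ := by
        gcongr
        refine (eLpNorm_one_le_of_sq hg).trans ?_
        gcongr

end Fidelity

section Semicontinuity

variable {Ω : Set (𝔼 d)} {u : ℕ → 𝔼 d → ℝ} {v : 𝔼 d → ℝ}

theorem IsDistribGradient.integral_congr {w : 𝔼 d → ℝ} {μ ν : VectorMeasure (𝔼 d) (𝔼 d)}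
    (hμ : IsDistribGradient Ω w μ) (hν : IsDistribGradient Ω w ν) {φ : 𝔼 d → ℝ}
    (hφ : IsTest Ω φ) : ∫ᵛ x, φ x ∂•μ = ∫ᵛ x, φ x ∂•ν := by
  rw [← neg_inj, ← hμ.integral_eq φ hφ.1 hφ.2 hφ.3, hν.integral_eq φ hφ.1 hφ.2 hφ.3]

theorem totalVariation_zero (hΩ : IsOpen Ω) : totalVariation Ω (fun _ ↦ 0) = 0 := by
  have h0 : IsDistribGradient Ω (fun _ ↦ 0) (0 : VectorMeasure (𝔼 d) (𝔼 d)) :=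
    ⟨by simp, by simp, fun φ _ _ _ ↦ by simp⟩
  have hD := isBV_zero (Ω := Ω) |>.isDistribGradient
  by_contra h
  -- both `0` and the chosen gradient represent the gradient of `0`, so semicontinuity compares them
  have hT : TestTendsto Ω (atTop : Filter ℕ) (fun _ ↦ (0 : VectorMeasure (𝔼 d) (𝔼 d)))
      (distribGradient Ω fun _ ↦ 0) := fun φ hφ ↦ by
    change Tendsto (fun _ : ℕ ↦ ∫ᵛ x, φ x ∂•(0 : VectorMeasure (𝔼 d) (𝔼 d))) _ _
    rw [h0.integral_congr hD hφ]
    exact tendsto_const_nhds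
  obtain ⟨n, hn⟩ := (hT.eventually_lt_variation hΩ (fun _ ↦ h0.finite) hD.finite hD.concentrated
    (pos_iff_ne_zero.2 h)).exists
  simp at hn

/-- Compactness in `BV`, for sequences that are eventually bounded. -/
theorem exists_subseq_tendsto_isBV (hΩ : IsOpen Ω) (hΩb : Bornology.IsBounded Ω)
    (hΩl : HasLipschitzBoundary Ω) (hu : ∀ n, IsBV Ω (u n)) {K : ℝ≥0∞} (hK : K ≠ ⊤)
    (h1 : ∀ᶠ n in atTop, eLpNorm (u n) 1 (volume.restrict Ω) ≤ K)
    (h2 : ∀ᶠ n in atTop, totalVariation Ω (u n) ≤ K) :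
    ∃ v : 𝔼 d → ℝ, IsBV Ω v ∧ ∃ φ : ℕ → ℕ, Tendsto φ atTop atTop ∧
      Tendsto (fun n ↦ ∫⁻ x in Ω, ‖u (φ n) x - v x‖ₑ) atTop (𝓝 0) := by
  obtain ⟨N, hN⟩ := eventually_atTop.1 (h1.and h2)
  have h1' : ∀ n, ∫ x in Ω, ‖u (n + N) x‖ ≤ K.toReal := by
    intro n
    rw [integral_norm_eq_lintegral_enorm (hu _).1.1, ← eLpNorm_one_eq_lintegral_enorm]
    exact ENNReal.toReal_mono hK (hN (n + N) (by omega)).1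
  obtain ⟨v, hv, φ, hφ, hlim⟩ := exists_subseq_tendsto_L1 hΩ hΩb hΩl (u := fun n ↦ u (n + N))
    (fun n ↦ (hu _).1) (fun n ↦ (hu _).isDistribGradient) h1'
    (fun n ↦ by
      rw [ENNReal.ofReal_toReal hK]
      exact (hN (n + N) (by omega)).2)
  refine ⟨v, ?_, fun n ↦ φ n + N, (tendsto_add_atTop_nat N).comp hφ.tendsto_atTop, hlim⟩
  refine isBV_of_tendsto_L1 hΩ hΩb (fun n ↦ (hu (φ n + N)).1) hv hlim
    (fun n ↦ (hu _).isDistribGradient) (C := K.toNNReal) fun n ↦ ?_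
  rw [ENNReal.coe_toNNReal hK]
  exact (hN (φ n + N) (by omega)).2

theorem totalVariation_le_of_tendsto (hΩ : IsOpen Ω) (hu : ∀ n, IsBV Ω (u n))
    (hv : IsBV Ω v) (hlim : Tendsto (fun n ↦ ∫⁻ x in Ω, ‖u n x - v x‖ₑ) atTop (𝓝 0)) {c : ℝ≥0∞}
    (hc : Tendsto (fun n ↦ totalVariation Ω (u n)) atTop (𝓝 c)) : totalVariation Ω v ≤ c :=
  le_of_forall_lt_imp_le_of_dense fun _ ha ↦ ge_of_tendsto hc
    ((eventually_lt_totalVariation hΩ hu hv hlim ha).mono fun _ h ↦ h.le)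

/-- If `uₙ` minimises the lower level problem for `pₙ → q` with `q` off the axes and `uₙ → v` in
`L¹`, then `v` minimises it for `q`. -/
theorem mem_lowerArgmin_of_tendsto (hΩ : IsOpen Ω) {f : 𝔼 d → ℝ} {p : ℕ → ℝ × ℝ} {q : ℝ × ℝ}
    (hp : Tendsto p atTop (𝓝 q)) (h1 : 0 < q.1) (h2 : 0 < q.2)
    (hu : ∀ n, u n ∈ lowerArgmin Ω f (p n).1 (p n).2) (hv : IsBV Ω v)
    (hlim : Tendsto (fun n ↦ ∫⁻ x in Ω, ‖u n x - v x‖ₑ) atTop (𝓝 0)) :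
    v ∈ lowerArgmin Ω f q.1 q.2 := by
  refine ⟨hv, fun w hw ↦ ?_⟩
  have key : ∀ a, (∀ᶠ n in atTop, a ≤ totalVariation Ω (u n)) → a + fidelity Ω q.1 q.2 v f ≤
      totalVariation Ω w + fidelity Ω q.1 q.2 w f := by
    intro a ha
    have hl : Tendsto (fun n ↦ ENNReal.ofReal (p n).1 * ∫⁻ x in Ω, ‖u n x - v x‖ₑ) atTop
        (𝓝 0) := by
      simpa using ENNReal.Tendsto.mul
        (ENNReal.tendsto_ofReal ((continuous_fst.tendsto q).comp hp)) (Or.inr (by simp)) hlim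
        (Or.inr (by simp))
    have hr := ((tendsto_fidelity (Ω := Ω) (u := w) (f := f) hp h1 h2).const_add
      (totalVariation Ω w)).add hl
    rw [add_zero] at hr
    refine le_of_tendsto_of_tendsto
      ((tendsto_fidelity (Ω := Ω) (u := v) (f := f) hp h1 h2).const_add a) hr ?_
    filter_upwards [ha] with n hn
    calc a + fidelity Ω (p n).1 (p n).2 v f
        ≤ totalVariation Ω (u n) + (fidelity Ω (p n).1 (p n).2 (u n) f +
            ENNReal.ofReal (p n).1 * ∫⁻ x in Ω, ‖u n x - v x‖ₑ) :=
          add_le_add hn (fidelity_le_add hv.1 (hu n).1.1)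
      _ ≤ _ := by
          rw [← add_assoc]
          exact add_le_add_left ((hu n).2 w hw) _
  rcases eq_or_ne (totalVariation Ω v) 0 with h0 | h0
  · rw [h0]
    exact key 0 (Eventually.of_forall fun _ ↦ zero_le)
  · obtain ⟨a, -, ha, hlima⟩ := exists_seq_strictMono_tendsto' (pos_iff_ne_zero.2 h0)
    exact le_of_tendsto' (hlima.add_const _) fun k ↦ key _
      ((eventually_lt_totalVariation hΩ (fun n ↦ (hu n).1) hv hlim (ha k).2).mono fun _ h ↦ h.le)

end Semicontinuity

/-! ### The bilevel problem -/

section Bilevel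

variable {Ω : Set (𝔼 d)} {f : 𝔼 d → ℝ} {F : (𝔼 d → ℝ) → ℝ≥0∞}

/-- Existence of optimal parameters for a cost functional `F` that is lower semicontinuous along
`L¹`-convergent sequences in `BV`, and that is coercive enough for a sequence with vanishing total
variation and convergent costs to be replaced by a function with zero total variation. -/
theorem exists_isBilevelOptimal (hΩ : IsOpen Ω) (hΩb : Bornology.IsBounded Ω)
    (hΩl : HasLipschitzBoundary Ω) (hf : MemLp f 2 (volume.restrict Ω)) {L₁ L₂ : ℝ} (hL₁ : 0 ≤ L₁)
    (hL₂ : 0 ≤ L₂)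
    (hlsc : ∀ (u : ℕ → 𝔼 d → ℝ) (v : 𝔼 d → ℝ) (c : ℝ≥0∞), (∀ n, IsBV Ω (u n)) → IsBV Ω v →
      Tendsto (fun n ↦ ∫⁻ x in Ω, ‖u n x - v x‖ₑ) atTop (𝓝 0) →
      Tendsto (fun n ↦ F (u n)) atTop (𝓝 c) → F v ≤ c)
    (hcoer : ∀ (u : ℕ → 𝔼 d → ℝ) (c : ℝ≥0∞), c ≠ ⊤ → (∀ n, IsBV Ω (u n)) →
      Tendsto (fun n ↦ totalVariation Ω (u n)) atTop (𝓝 0) →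
      Tendsto (fun n ↦ F (u n)) atTop (𝓝 c) →
      ∃ v, IsBV Ω v ∧ totalVariation Ω v = 0 ∧ F v ≤ c) :
    ∃ p : ℝ × ℝ, IsBilevelOptimal Ω f F (Icc 0 L₁ ×ˢ Icc 0 L₂) p := by
  have hΩv : volume Ω ≠ ⊤ := hΩb.measure_lt_top.ne
  have : IsFiniteMeasure (volume.restrict Ω) := ⟨by simpa using hΩv.lt_top⟩
  have hf1 : IntegrableOn f Ω := hf.integrable (by norm_num)
  have hfn : eLpNorm f 1 (volume.restrict Ω) ≠ ⊤ := (memLp_one_iff_integrable.2 hf1).2.ne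
  -- on the axes, the functions without variation are solutions of the lower level problem
  have haxes : ∀ q : ℝ × ℝ, q.1 = 0 ∨ q.2 = 0 → ∀ v, IsBV Ω v → totalVariation Ω v = 0 →
      v ∈ lowerArgmin Ω f q.1 q.2 := by
    intro q hq v hv hv0
    refine ⟨hv, fun w _ ↦ ?_⟩
    have h0 : fidelity Ω q.1 q.2 v f = 0 := by
      rcases hq with h | h
      · rw [h, fidelity_zero_left hv.1 hf1]
      · rw [h, fidelity_zero_right]
    rw [hv0, h0, add_zero]
    exact zero_le
  -- it suffices that some admissible cost is at most the infimum of the admissible costs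
  let S : Set ℝ≥0∞ := {c | ∃ q ∈ Icc 0 L₁ ×ˢ Icc 0 L₂, ∃ w ∈ lowerArgmin Ω f q.1 q.2, F w = c}
  suffices h : ∃ p ∈ Icc 0 L₁ ×ˢ Icc 0 L₂, ∃ u ∈ lowerArgmin Ω f p.1 p.2, F u ≤ sInf S by
    obtain ⟨p, hp, u, hu, hFu⟩ := h
    exact ⟨p, hp, u, hu, fun q hq w hw ↦ hFu.trans (sInf_le ⟨q, hq, w, hw, rfl⟩)⟩
  have h00 : ((0 : ℝ), (0 : ℝ)) ∈ Icc 0 L₁ ×ˢ Icc 0 L₂ := ⟨⟨le_rfl, hL₁⟩, ⟨le_rfl, hL₂⟩⟩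
  have hzero := haxes (0, 0) (Or.inl rfl) _ isBV_zero (totalVariation_zero hΩ)
  rcases eq_or_ne (sInf S) ⊤ with htop | htop
  · exact ⟨(0, 0), h00, _, hzero, htop ▸ le_top⟩
  obtain ⟨s, -, hs, hsS⟩ := exists_seq_tendsto_sInf (S := S) ⟨_, _, h00, _, hzero, rfl⟩
    (OrderBot.bddBelow S)
  choose p₀ hp₀ u₀ hu₀ hF₀ using hsS
  obtain ⟨q, hq, φ, hφ, hlimp⟩ := (isCompact_Icc.prod isCompact_Icc).tendsto_subseq hp₀
  let p : ℕ → ℝ × ℝ := p₀ ∘ φ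
  let u : ℕ → 𝔼 d → ℝ := u₀ ∘ φ
  have hp : ∀ n, p n ∈ Icc 0 L₁ ×ˢ Icc 0 L₂ := fun n ↦ hp₀ _
  have hu : ∀ n, u n ∈ lowerArgmin Ω f (p n).1 (p n).2 := fun n ↦ hu₀ _
  have hF : Tendsto (fun n ↦ F (u n)) atTop (𝓝 (sInf S)) := by
    refine (hs.comp hφ.tendsto_atTop).congr fun n ↦ ?_
    simp only [u, Function.comp_apply, hF₀]
  have hlimp : Tendsto p atTop (𝓝 q) := hlimp
  have hlim1 : Tendsto (fun n ↦ (p n).1) atTop (𝓝 q.1) := (continuous_fst.tendsto q).comp hlimp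
  have hlim2 : Tendsto (fun n ↦ (p n).2) atTop (𝓝 q.2) := (continuous_snd.tendsto q).comp hlimp
  have henergy : ∀ n, totalVariation Ω (u n) + fidelity Ω (p n).1 (p n).2 (u n) f ≤
      fidelity Ω (p n).1 (p n).2 (fun _ ↦ 0) f := by
    intro n
    refine ((hu n).2 _ isBV_zero).trans_eq ?_
    rw [totalVariation_zero hΩ, zero_add]
  by_cases hpos : q.1 = 0 ∨ q.2 = 0
  · have h0 : Tendsto (fun n ↦ fidelity Ω (p n).1 (p n).2 (fun _ ↦ 0) f) atTop (𝓝 0) := by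
      rcases hpos with h | h
      · rw [h] at hlim1
        have := ENNReal.Tendsto.mul_const (ENNReal.tendsto_ofReal hlim1) (Or.inr hfn)
        rw [ENNReal.ofReal_zero, zero_mul] at this
        exact tendsto_of_tendsto_of_tendsto_of_le_of_le tendsto_const_nhds this
          (fun _ ↦ zero_le) fun n ↦ fidelity_zero_le_left hf1
      · rw [h] at hlim2
        have := ENNReal.Tendsto.mul_const (ENNReal.tendsto_ofReal (hlim2.div_const 2))
          (Or.inr (ENNReal.pow_ne_top (n := 2) hf.2.ne))
        rw [zero_div, ENNReal.ofReal_zero, zero_mul] at this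
        exact tendsto_of_tendsto_of_tendsto_of_le_of_le tendsto_const_nhds this
          (fun _ ↦ zero_le) fun n ↦ fidelity_zero_le_right
    have hTV : Tendsto (fun n ↦ totalVariation Ω (u n)) atTop (𝓝 0) :=
      tendsto_of_tendsto_of_tendsto_of_le_of_le tendsto_const_nhds h0 (fun _ ↦ zero_le)
        fun n ↦ le_self_add.trans (henergy n)
    obtain ⟨v, hv, hv0, hFv⟩ := hcoer u _ htop (fun n ↦ (hu n).1) hTV hF
    exact ⟨q, hq, v, haxes q hpos v hv hv0, hFv⟩
  · push Not at hpos
    have hq1 : 0 < q.1 := lt_of_le_of_ne hq.1.1 (Ne.symm hpos.1)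
    have hq2 : 0 < q.2 := lt_of_le_of_ne hq.2.1 (Ne.symm hpos.2)
    let C : ℝ≥0∞ := ENNReal.ofReal L₁ * eLpNorm f 1 (volume.restrict Ω)
    have hC : C ≠ ⊤ := ENNReal.mul_ne_top ENNReal.ofReal_ne_top hfn
    have henergy' : ∀ n, totalVariation Ω (u n) + fidelity Ω (p n).1 (p n).2 (u n) f ≤ C := by
      intro n
      refine (henergy n).trans ((fidelity_zero_le_left hf1).trans ?_)
      exact mul_le_mul_left (ENNReal.ofReal_le_ofReal (hp n).1.2) _
    obtain ⟨K, hK, hKu⟩ := exists_eLpNorm_one_le hΩv hf1 hC (half_pos hq1) (half_pos hq2)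
    have hL1 : ∀ᶠ n in atTop, eLpNorm (u n) 1 (volume.restrict Ω) ≤ max K C := by
      filter_upwards [hlim1.eventually_const_lt (half_lt_self hq1),
        hlim2.eventually_const_lt (half_lt_self hq2)] with n h1 h2
      exact (hKu _ _ _ (hu n).1.1 h1.le h2.le (le_add_self.trans (henergy' n))).trans
        (le_max_left _ _)
    obtain ⟨v, hv, ψ, hψ, hlim⟩ := exists_subseq_tendsto_isBV hΩ hΩb hΩl (fun n ↦ (hu n).1)
      (K := max K C) (by simp [hK, hC]) hL1
      (Eventually.of_forall fun n ↦ (le_self_add.trans (henergy' n)).trans (le_max_right _ _))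
    exact ⟨q, hq, v, mem_lowerArgmin_of_tendsto hΩ (hlimp.comp hψ) hq1 hq2 (fun n ↦ hu (ψ n)) hv
      hlim, hlsc _ v _ (fun n ↦ (hu (ψ n)).1) hv hlim (hF.comp hψ)⟩

end Bilevel

section Costs

variable {Ω : Set (𝔼 d)} {utilde : 𝔼 d → ℝ} {u : ℕ → 𝔼 d → ℝ} {v : 𝔼 d → ℝ} {c : ℝ≥0∞}

/-- Lower semicontinuity of the `L²` cost under `L¹` convergence: Fatou's lemma along an almost
everywhere convergent subsequence. -/
theorem costL2_le_of_tendsto (hut : MemLp utilde 2 (volume.restrict Ω))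
    (hu : ∀ n, IntegrableOn (u n) Ω) (hv : IntegrableOn v Ω)
    (hlim : Tendsto (fun n ↦ ∫⁻ x in Ω, ‖u n x - v x‖ₑ) atTop (𝓝 0))
    (hc : Tendsto (fun n ↦ costL2 Ω utilde (u n)) atTop (𝓝 c)) : costL2 Ω utilde v ≤ c := by
  have h1 : TendstoInMeasure (volume.restrict Ω) u atTop v := by
    refine tendstoInMeasure_of_tendsto_eLpNorm one_ne_zero (fun n ↦ (hu n).1) hv.1 ?_
    refine hlim.congr fun n ↦ ?_
    rw [eLpNorm_one_eq_lintegral_enorm]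
    rfl
  obtain ⟨φ, hφ, hae⟩ := h1.exists_seq_tendsto_ae
  have h2 : eLpNorm (fun x ↦ v x - utilde x) 2 (volume.restrict Ω) ≤
      liminf (fun n ↦ eLpNorm (fun x ↦ u (φ n) x - utilde x) 2 (volume.restrict Ω)) atTop := by
    refine Lp.eLpNorm_lim_le_liminf_eLpNorm (fun n ↦ (hu _).1.sub hut.1) _ ?_
    filter_upwards [hae] with x hx using hx.sub_const _
  have hsqrt : ∀ x : ℝ≥0∞, (x ^ 2) ^ (1 / 2 : ℝ) = x := fun x ↦ by
    rw [← ENNReal.rpow_natCast, ← ENNReal.rpow_mul]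
    norm_num
  have h3 : Tendsto (fun n ↦ eLpNorm (fun x ↦ u (φ n) x - utilde x) 2 (volume.restrict Ω)) atTop
      (𝓝 (c ^ (1 / 2 : ℝ))) := by
    refine ((ENNReal.continuous_rpow_const.tendsto c).comp (hc.comp hφ.tendsto_atTop)).congr
      fun n ↦ ?_
    exact hsqrt _
  rw [h3.liminf_eq] at h2
  calc costL2 Ω utilde v ≤ (c ^ (1 / 2 : ℝ)) ^ 2 := pow_le_pow_left' h2 2
    _ = c := by
      rw [← ENNReal.rpow_natCast, ← ENNReal.rpow_mul]
      norm_num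

/-- A sequence with vanishing total variation and convergent `L²` costs is bounded in `L¹` by its
costs, and thus has a limit point in `L¹`, whose total variation vanishes. -/
theorem exists_costL2_le (hΩ : IsOpen Ω) (hΩb : Bornology.IsBounded Ω)
    (hΩl : HasLipschitzBoundary Ω) (hut : MemLp utilde 2 (volume.restrict Ω)) (hct : c ≠ ⊤)
    (hu : ∀ n, IsBV Ω (u n)) (hTV : Tendsto (fun n ↦ totalVariation Ω (u n)) atTop (𝓝 0))
    (hc : Tendsto (fun n ↦ costL2 Ω utilde (u n)) atTop (𝓝 c)) :
    ∃ v, IsBV Ω v ∧ totalVariation Ω v = 0 ∧ costL2 Ω utilde v ≤ c := by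
  have hΩv : volume Ω ≠ ⊤ := hΩb.measure_lt_top.ne
  have : IsFiniteMeasure (volume.restrict Ω) := ⟨by simpa using hΩv.lt_top⟩
  have hut1 : IntegrableOn utilde Ω := hut.integrable (by norm_num)
  have hutn : eLpNorm utilde 1 (volume.restrict Ω) ≠ ⊤ := (memLp_one_iff_integrable.2 hut1).2.ne
  let K : ℝ≥0∞ := eLpNorm utilde 1 (volume.restrict Ω) +
    (1 + (c + 1)) * volume Ω ^ (1 / 2 : ℝ) + 1
  have hK : K ≠ ⊤ := by
    have h4 : volume Ω ^ (1 / 2 : ℝ) ≠ ⊤ := ENNReal.rpow_ne_top_of_nonneg (by norm_num) hΩv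
    finiteness
  have h1 : ∀ᶠ n in atTop, eLpNorm (u n) 1 (volume.restrict Ω) ≤ K := by
    filter_upwards [hc.eventually_lt_const (ENNReal.lt_add_right hct one_ne_zero)] with n hn
    have hg : AEStronglyMeasurable (fun x ↦ u n x - utilde x) (volume.restrict Ω) :=
      (hu n).1.1.sub hut.1
    have h2 : u n = utilde + fun x ↦ u n x - utilde x := by
      ext x
      simp
    calc eLpNorm (u n) 1 (volume.restrict Ω)
        = eLpNorm (utilde + fun x ↦ u n x - utilde x) 1 (volume.restrict Ω) := by rw [← h2]
      _ ≤ eLpNorm utilde 1 (volume.restrict Ω) +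
          (1 + (c + 1)) * volume Ω ^ (1 / 2 : ℝ) := by
        refine (eLpNorm_add_le hut.1 hg le_rfl).trans ?_
        gcongr
        refine (eLpNorm_one_le_of_sq hg).trans ?_
        gcongr
        exact hn.le
      _ ≤ K := le_self_add
  obtain ⟨v, hv, φ, hφ, hlim⟩ := exists_subseq_tendsto_isBV hΩ hΩb hΩl hu hK h1
    (by
      filter_upwards [hTV.eventually_lt_const zero_lt_one] with n hn
      exact hn.le.trans le_add_self)
  exact ⟨v, hv, le_antisymm
    (totalVariation_le_of_tendsto hΩ (fun n ↦ hu (φ n)) hv hlim (hTV.comp hφ)) zero_le,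
    costL2_le_of_tendsto hut (fun n ↦ (hu (φ n)).1) hv.1 hlim (hc.comp hφ)⟩

variable {γ : ℝ}

/-- Lower semicontinuity of the Huberised TV cost, for distributional convergence. -/
theorem costHuberTV_le_of_testTendsto (hγ : 1 / 2 ≤ γ) (hΩ : IsOpen Ω) (hΩv : volume Ω ≠ ⊤)
    (hut : IsBV Ω utilde) (hu : ∀ n, IsBV Ω (u n)) (hv : IsBV Ω v)
    (h : TestTendsto Ω atTop (fun n ↦ distribGradient Ω fun x ↦ u n x - utilde x)
      (distribGradient Ω fun x ↦ v x - utilde x))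
    (hc : Tendsto (fun n ↦ costHuberTV Ω γ utilde (u n)) atTop (𝓝 c)) :
    costHuberTV Ω γ utilde v ≤ c := by
  refine le_of_forall_lt_imp_le_of_dense fun a ha ↦ ge_of_tendsto hc ?_
  have hd := (hv.sub hut).isDistribGradient
  exact (h.eventually_lt_huberVariation hγ hΩ hΩv
    (fun n ↦ ((hu n).sub hut).isDistribGradient.finite) hd.finite ha).mono
      fun _ h ↦ h.le

/-- Linearity of `D`, tested with test functions: `distribGradient` is a choice of representing
measure, so the measures themselves are not compared. -/
theorem IsBV.integral_distribGradient_sub {w : 𝔼 d → ℝ} (hw : IsBV Ω w) (hut : IsBV Ω utilde)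
    {φ : 𝔼 d → ℝ} (hφ : IsTest Ω φ) :
    ∫ᵛ x, φ x ∂•(distribGradient Ω fun x ↦ w x - utilde x) =
      ∫ᵛ x, φ x ∂•(distribGradient Ω w) - ∫ᵛ x, φ x ∂•(distribGradient Ω utilde) := by
  have : IsFiniteMeasure (distribGradient Ω w).variation := ⟨hw.isDistribGradient.finite.lt_top⟩
  have : IsFiniteMeasure (distribGradient Ω utilde).variation :=
    ⟨hut.isDistribGradient.finite.lt_top⟩
  rw [← VectorMeasure.integral_sub_vectorMeasure (hφ.integrable _) (hφ.integrable _)]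
  exact (hw.sub hut).isDistribGradient.integral_congr
    (hw.isDistribGradient.sub hw.1 hut.1 hut.isDistribGradient) hφ

/-- A sequence with vanishing total variation costs at least as much as `0` in the limit: no
compactness is needed since the cost sees `u` only through `Du`. -/
theorem costHuberTV_zero_le (hγ : 1 / 2 ≤ γ) (hΩ : IsOpen Ω) (hΩv : volume Ω ≠ ⊤)
    (hut : IsBV Ω utilde) (hu : ∀ n, IsBV Ω (u n))
    (hTV : Tendsto (fun n ↦ totalVariation Ω (u n)) atTop (𝓝 0))
    (hc : Tendsto (fun n ↦ costHuberTV Ω γ utilde (u n)) atTop (𝓝 c)) :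
    costHuberTV Ω γ utilde (fun _ ↦ 0) ≤ c := by
  refine costHuberTV_le_of_testTendsto hγ hΩ hΩv hut hu isBV_zero (fun φ hφ ↦ ?_) hc
  rw [isBV_zero.integral_distribGradient_sub hut hφ]
  simp_rw [fun n ↦ (hu n).integral_distribGradient_sub hut hφ]
  refine Tendsto.sub_const ?_ _
  have h0 : ∫ᵛ x, φ x ∂•(distribGradient Ω fun _ ↦ (0 : ℝ)) = 0 := by
    rw [← neg_eq_zero, ← isBV_zero.isDistribGradient.integral_eq φ hφ.1 hφ.2 hφ.3]
    simp
  rw [h0]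
  obtain ⟨B, hB⟩ := hφ.hasCompactSupport.exists_bound_of_continuous hφ.contDiff.continuous
  have hTV' := (ENNReal.tendsto_toReal ENNReal.zero_ne_top).comp hTV
  rw [ENNReal.toReal_zero] at hTV'
  refine squeeze_zero_norm (a := fun n ↦ |B| * (totalVariation Ω (u n)).toReal) (fun n ↦ ?_)
    (by simpa using hTV'.const_mul |B|)
  have hd := (hu n).isDistribGradient
  have : IsFiniteMeasure (distribGradient Ω (u n)).variation := ⟨hd.finite.lt_top⟩
  refine (VectorMeasure.norm_integral_le_of_norm_le_const (C := |B|)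
    (ae_of_all _ fun x ↦ (hB x).trans (le_abs_self B))).trans ?_
  rw [measureReal_def, hd.variation_eq hΩ.measurableSet]
  refine mul_le_mul_of_nonneg_right ?_ ENNReal.toReal_nonneg
  exact mul_le_of_le_one_right (abs_nonneg B) norm_lsmul_le_one

end Costs

end TVIC

theorem proposition4p3 {d : ℕ} (hd : 0 < d) (Ω : Set (EuclideanSpace ℝ (Fin d)))
    (hΩ_open : IsOpen Ω) (hΩ_bdd : Bornology.IsBounded Ω) (hΩ_conn : IsConnected Ω)
    (hΩ_lip : TVIC.HasLipschitzBoundary Ω)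
    (f : EuclideanSpace ℝ (Fin d) → ℝ) (hf : MemLp f 2 (volume.restrict Ω))
    (L₁ L₂ : ℝ) (hL₁ : 0 < L₁) (hL₂ : 0 < L₂) :
    (∀ utilde : EuclideanSpace ℝ (Fin d) → ℝ, MemLp utilde 2 (volume.restrict Ω) →
      ∃ p : ℝ × ℝ,
        TVIC.IsBilevelOptimal Ω f (TVIC.costL2 Ω utilde) (Icc 0 L₁ ×ˢ Icc 0 L₂) p) ∧
    (∀ γ : ℝ, 1 / 2 ≤ γ → ∀ utilde : EuclideanSpace ℝ (Fin d) → ℝ, TVIC.IsBV Ω utilde →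
      ∃ p : ℝ × ℝ,
        TVIC.IsBilevelOptimal Ω f (TVIC.costHuberTV Ω γ utilde) (Icc 0 L₁ ×ˢ Icc 0 L₂) p) := by
  have hΩv : volume Ω ≠ ⊤ := hΩ_bdd.measure_lt_top.ne
  refine ⟨fun utilde hut ↦ ?_, fun γ hγ utilde hut ↦ ?_⟩
  · refine TVIC.exists_isBilevelOptimal hΩ_open hΩ_bdd hΩ_lip hf hL₁.le hL₂.le ?_ ?_
    · intro u v c hu hv hlim hc
      exact TVIC.costL2_le_of_tendsto hut (fun n ↦ (hu n).1) hv.1 hlim hc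
    · intro u c hc hu hTV hF
      exact TVIC.exists_costL2_le hΩ_open hΩ_bdd hΩ_lip hut hc hu hTV hF
  · refine TVIC.exists_isBilevelOptimal hΩ_open hΩ_bdd hΩ_lip hf hL₁.le hL₂.le ?_ ?_
    · intro u v c hu hv hlim hc
      refine TVIC.costHuberTV_le_of_testTendsto hγ hΩ_open hΩv hut hu hv ?_ hc
      exact TVIC.testTendsto_of_tendsto_L1 (fun n ↦ ((hu n).sub hut).1) (hv.sub hut).1
        (by simpa using hlim) (fun n ↦ ((hu n).sub hut).isDistribGradient)
        (hv.sub hut).isDistribGradient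
    · intro u c _ hu hTV hF
      exact ⟨_, TVIC.isBV_zero, TVIC.totalVariation_zero hΩ_open,
        TVIC.costHuberTV_zero_le hγ hΩ_open hΩv hut hu hTV hF⟩
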